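/- \textbf{Notation.} For a positive integer $k$ and $m_1,\dots,m_{k-1}\in\mathbb Z$ put \[Q(m_1,\dots,m_{k-1})=\sum_{i=1}^{k-1}m_i^2+\sum_{1\le i<j\le k-1}m_im_j,\] and for $z\in\mathbb H$ put $q=e^{2\pi i z}$. Let $\left(\frac{\cdot}{\cdot}\right)$ be the Kronecker symbol. For an odd integer $d$ put $\varepsilon_d=1$ if $d\equiv1\pmod 4$ and $\varepsilon_d=i$ if $d\equiv3\pmod 4$. Square roots are principal (argument in $(-\pi/2,\pi/2]$), and $w^{\kappa/2}=(\sqrt w)^{\kappa}$ for an integer $\kappa$. For an integer $\kappa$, a positive integer $N$ (with $4\mid N$ if $\kappa$ is odd) and a Dirichlet character $\chi$ modulo $N$, let $M_{\kappa/2}(\Gamma_0(N),\chi)$ [resp. $M^!_{\kappa/2}(\Gamma_0(N),\chi)$] be the space of holomorphic functions $f:\mathbb H\to\mathbb C$ such that for all $\gamma=\begin{pmatrix}a&b\\c&d\end{pmatrix}\in\Gamma_0(N)$ and $z\in\mathbb H$ \[f(\gamma z)=\begin{cases}\chi(d)\,(cz+d)^{\kappa/2}f(z)&\kappa\text{ even},\\[2pt]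 \chi(d)\left(\frac cd\right)^{\kappa}\varepsilon_d^{-\kappa}(cz+d)^{\kappa/2}f(z)&\kappa\text{ odd},\end{cases}\] and which are holomorphic [resp. meromorphic] at the cusps: for every $\gamma=\begin{pmatrix}a&b\\c&d\end{pmatrix}\in\mathrm{SL}_2(\mathbb Z)$ there are an integer $h\ge1$ and an expansion $(cz+d)^{-\kappa/2}f(\gamma z)=\sum_{n\ge n_0}a_n e^{2\pi i nz/h}$, convergent for all $z\in\mathbb H$, with $n_0=0$ [resp. with some $n_0\in\mathbb Z$]. \textbf{Lemma.} Let $k$ be a positive integer. The series \[\theta_k(z)=\sum_{(m_1,\dots,m_{k-1})\in\mathbb Z^{k-1}}q^{Q(m_1,\dots,m_{k-1})}\] converges absolutely for every $z\in\mathbb H$ (for $k=1$ it is the constant $1$), and the following hold. \begin{enumerate} \item[(a)] If $k$ is odd, then $\chi_k(d)=\left(\frac{(-1)^{(k-1)/2}k}{d}\right)$, $d\in\mathbb Z$, is a Dirichlet character modulo $k$, and $\theta_k\in M_{(k-1)/2}(\Gamma_0(k),\chi_k)$. \item[(b)] If $k$ is even, then $\chi_k(d)=\left(\frac{2k}{d}\right)$,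 $d\in\mathbb Z$, is a Dirichlet character modulo $2k$, and $\theta_k\in M^!_{(k-1)/2}(\Gamma_0(2k),\chi_k)$. \end{enumerate} -/

import Mathlib

open scoped UpperHalfPlane MatrixGroups Manifold

noncomputable section

namespace FrobTheta

/-- The Kronecker symbol `(a / n)` for arbitrary integers `a`, `n`: the completely multiplicative
extension in `n` of the Legendre symbol, with `(a / -1) = -1` exactly when `a < 0`,
`(a / 2) = 0, 1, -1` according as `a` is even, `a ≡ ±1 (mod 8)`, `a ≡ ±3 (mod 8)`,
and `(a / 0) = 1` if `a = ±1`, `(a / 0) = 0` otherwise. -/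
def kroneckerSym (a n : ℤ) : ℤ :=
  if n = 0 then (if a = 1 ∨ a = -1 then 1 else 0)
  else (if n < 0 ∧ a < 0 then -1 else 1)
    * ZMod.χ₈ (a : ZMod 8) ^ n.natAbs.factorization 2
    * jacobiSym a (n.natAbs / 2 ^ n.natAbs.factorization 2)

/-- `ε_d = 1` if `d ≡ 1 (mod 4)` and `ε_d = i` if `d ≡ 3 (mod 4)` (used for odd `d` only). -/
def eps (d : ℤ) : ℂ := if d % 4 = 1 then 1 else Complex.I

/-- `c z + d`, where `(c, d)` is the bottom row of `γ`. -/
def cocyc (γ : SL(2, ℤ)) (z : ℍ) : ℂ := (γ 1 0 : ℂ) * (z : ℂ) + (γ 1 1 : ℂ)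

/-- The principal branch of `(c z + d)^{1/2}`, with argument in `(-π/2, π/2]`. -/
def sqrtCocyc (γ : SL(2, ℤ)) (z : ℍ) : ℂ := cocyc γ z ^ (1 / 2 : ℂ)

/-- The automorphy factor of weight `κ/2`.
For `κ` even it is `(c z + d)^{κ/2}` (the exponent being an integer), for `κ` odd it is
`j(γ, z)^κ` with the theta multiplier `j(γ, z) = (c / d) ε_d⁻¹ (c z + d)^{1/2}`. -/
def autFactor (κ : ℤ) (γ : SL(2, ℤ)) (z : ℍ) : ℂ :=
  if Even κ then cocyc γ z ^ (κ / 2)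
  else ((kroneckerSym (γ 1 0) (γ 1 1) : ℂ) * (eps (γ 1 1))⁻¹ * sqrtCocyc γ z) ^ κ

/-- `f(γ z) = χ(d) J(γ, z) f(z)` for all `γ ∈ Γ₀(N)`, with `J` the automorphy factor of
weight `κ/2`. (When `κ` is odd this is used, as always, with `4 ∣ N`.) -/
def Transforms (κ : ℤ) (N : ℕ) (χ : DirichletCharacter ℂ N) (f : ℍ → ℂ) : Prop :=
  ∀ γ ∈ CongruenceSubgroup.Gamma0 N, ∀ z : ℍ,
    f (γ • z) = χ ((γ 1 1 : ℤ) : ZMod N) * autFactor κ γ z * f z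

/-- The function `z ↦ (c z + d)^{-κ/2} f(γ z)` has, for some width `h ≥ 1`, an expansion in powers
of `e^{2πiz/h}` in which all exponents are `≥ n₀`. As `γ` varies over `SL₂(ℤ)` this describes the
behaviour of `f` at the cusp `γ ∞`. -/
def HasCuspExpansion (κ : ℤ) (f : ℍ → ℂ) (γ : SL(2, ℤ)) (n₀ : ℤ) : Prop :=
  ∃ h : ℕ, 0 < h ∧ ∃ a : ℕ → ℂ, ∀ z : ℍ,
    HasSum (fun n : ℕ => a n * Function.Periodic.qParam (h : ℝ) (z : ℂ) ^ (n₀ + (n : ℤ)))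
      (sqrtCocyc γ z ^ (-κ) * f (γ • z))

/-- The space `M_{κ/2}(Γ₀(N), χ)` of holomorphic modular forms of weight `κ/2`:
holomorphic on `ℍ`, with the transformation law, and holomorphic at every cusp. -/
def holModForms (κ : ℤ) (N : ℕ) (χ : DirichletCharacter ℂ N) : Set (ℍ → ℂ) :=
  {f | MDiff f ∧ Transforms κ N χ f ∧ ∀ γ : SL(2, ℤ), HasCuspExpansion κ f γ 0}

/-- The space `M^!_{κ/2}(Γ₀(N), χ)` of weakly holomorphic modular forms of weight `κ/2`:
holomorphic on `ℍ`, with the transformation law, and meromorphic at every cusp. -/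
def weakHolModForms (κ : ℤ) (N : ℕ) (χ : DirichletCharacter ℂ N) : Set (ℍ → ℂ) :=
  {f | MDiff f ∧ Transforms κ N χ f ∧ ∀ γ : SL(2, ℤ), ∃ n₀ : ℤ, HasCuspExpansion κ f γ n₀}

/-- The quadratic form `Q(m₁, …, m_r) = ∑ mᵢ² + ∑_{i < j} mᵢ mⱼ`. -/
def Q {r : ℕ} (m : Fin r → ℤ) : ℤ :=
  ∑ i, m i ^ 2 + ∑ i, ∑ j ∈ Finset.Ioi i, m i * m j

/-- The term `q^{Q(m)}`, `q = e^{2πiz}`, of the theta series. -/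
def thetaTerm {r : ℕ} (z : ℍ) (m : Fin r → ℤ) : ℂ :=
  Complex.exp (2 * Real.pi * Complex.I * (z : ℂ)) ^ Q m

/-- The theta series `∑_{m ∈ ℤ^{k-1}} q^{Q(m)}` (for `k ≥ 1`). -/
def theta (k : ℕ) (z : ℍ) : ℂ := ∑' m : Fin (k - 1) → ℤ, thetaTerm z m

end FrobTheta

end

noncomputable section

namespace FrobTheta

open scoped NumberTheorySymbols

/-! ### Kronecker symbols -/

/-! Put `r = k - 1`. Since `2 Q(m)` is the squared norm of `(m, -∑ mᵢ)`, `θ_k` is the theta series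
of the root lattice `A_r`, the sum-zero vectors of `ℤ^k`. Everything is deduced from the Jacobi
theta function `θ(u, τ)`.

Expanding `θ(u, τ)^k` over `ℤ^k` and sorting by coordinate sum modulo `k` gives `θ(u, τ)^k = ∑
h_t(τ) ϑ_t(τ, u)` (`jacobiTheta₂_pow_eq`). Here the `h_t` are the theta series of the cosets of
`A_r` in its dual, with `h_0 = θ_k`, and `ϑ_0 = θ(ku, kτ)`. Averaging over the translates `u + j/k`
against a character isolates one term (`sum_jacobiTheta₂_pow`).

Transformation law. A Euclidean descent with even steps proves the law of `θ(u, τ)` for all matrices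
with even off-diagonal entries, with explicit multiplier (`jacobiLaw_of_even`). A matrix `(a, b; kc,
d)` with `b`, `c` even permutes the translates by `j ↦ jd`, and acts on `kτ` through `(a, kb; c,
d)`, which is again of that type. Dividing by a nonzero value of `θ(ku, kτ)` leaves the law of
`h_0`, with multiplier a quotient of theta multipliers (`cosetTheta_zero_transform`). Kronecker
symbol identities and quadratic reciprocity turn this quotient into the stated character. The
remaining parity conditions are removed by `h_0(τ + 1) = h_0(τ)` and, for odd `k`, by lower
unipotents of level `k`, which come from the inversion formula.

Cusps. `T` acts diagonally on the `h_t` and inversion acts by a finite Fourier transform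
(`cosetTheta_neg_one_div`), so their span is stable under `SL₂(ℤ)` in weight `r/2`. By
Cauchy–Schwarz each `h_t` has only nonnegative exponents. Hence `θ_k` is holomorphic at all cusps,
for even `k` too. -/

theorem kroneckerSym_of_odd {n : ℤ} (hn : Odd n) (a : ℤ) :
    kroneckerSym a n = (if n < 0 ∧ a < 0 then -1 else 1) * J(a | n.natAbs) := by
  have h0 : n ≠ 0 := by rintro rfl; simp at hn
  have h2 : n.natAbs.factorization 2 = 0 := by
    apply Nat.factorization_eq_zero_of_not_dvd
    have : Odd n.natAbs := Int.natAbs_odd.2 hn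
    exact this.not_two_dvd_nat
  simp [kroneckerSym, h0, h2]

theorem kroneckerSym_of_odd_of_nonneg_left {n : ℤ} (hn : Odd n) {a : ℤ} (ha : 0 ≤ a) :
    kroneckerSym a n = J(a | n.natAbs) := by
  rw [kroneckerSym_of_odd hn, if_neg (by lia), one_mul]

theorem kroneckerSym_of_odd_of_pos {n : ℤ} (hn : Odd n) (h : 0 < n) (a : ℤ) :
    kroneckerSym a n = J(a | n.natAbs) := by
  rw [kroneckerSym_of_odd hn, if_neg (by lia), one_mul]

theorem kroneckerSym_mul_left {n : ℤ} (hn : Odd n) {a b : ℤ} (ha : a ≠ 0) (hb : b ≠ 0) :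
    kroneckerSym (a * b) n = kroneckerSym a n * kroneckerSym b n := by
  simp only [kroneckerSym_of_odd hn, jacobiSym.mul_left]
  by_cases hneg : n < 0
  · rcases lt_or_gt_of_ne ha with h | h <;> rcases lt_or_gt_of_ne hb with h' | h'
    · simp [hneg, h, h', (mul_pos_of_neg_of_neg h h').not_gt]
    · simp [hneg, h, h'.not_gt, mul_neg_of_neg_of_pos h h']
    · simp [hneg, h.not_gt, h', mul_neg_of_pos_of_neg h h']
    · simp [hneg, h.not_gt, h'.not_gt, (mul_pos h h').not_gt]
  · simp [hneg]

theorem kroneckerSym_four_mul {n : ℤ} (hn : Odd n) (a : ℤ) :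
    kroneckerSym (4 * a) n = kroneckerSym a n := by
  rcases eq_or_ne a 0 with rfl | ha
  · simp
  · rw [kroneckerSym_mul_left hn (by norm_num) ha,
      kroneckerSym_of_odd_of_nonneg_left hn (by norm_num),
      jacobiSym.at_four (Int.natAbs_odd.2 hn), one_mul]

theorem kroneckerSym_neg_one {n : ℤ} (hn : Odd n) : kroneckerSym (-1) n = ZMod.χ₄ n := by
  rw [kroneckerSym_of_odd hn, jacobiSym.at_neg_one (Int.natAbs_odd.2 hn)]
  rcases lt_or_ge n 0 with h | h
  · obtain ⟨m, hm⟩ := Int.eq_ofNat_of_zero_le (by lia : 0 ≤ -n)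
    obtain rfl : n = -m := by lia
    have : (ZMod.χ₄ (-(m : ZMod 4))) = - ZMod.χ₄ m := by
      generalize (m : ZMod 4) = x
      revert x; decide
    rw [if_pos ⟨h, by norm_num⟩, Int.natAbs_neg, Int.natAbs_natCast, Int.cast_neg,
      Int.cast_natCast, this, neg_one_mul]
  · lift n to ℕ using h
    simp

theorem kroneckerSym_sq {a n : ℤ} (hn : Odd n) (h : IsCoprime a n) : kroneckerSym a n ^ 2 = 1 := by
  rw [kroneckerSym_of_odd hn, mul_pow, jacobiSym.sq_one]
  · split_ifs <;> norm_num
  · rw [Int.isCoprime_iff_gcd_eq_one] at h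
    rwa [Int.gcd, Int.natAbs_natCast]

theorem jacobiSym_four_mul_sub_one {a : ℕ} (ha : 0 < a) : J(a | 4 * a - 1) = 1 := by
  have hodd : Odd (4 * a - 1) := by rw [Nat.odd_iff]; lia
  have h : J((4 * a : ℤ) | 4 * a - 1) = 1 := by
    rw [jacobiSym.mod_left' (a₂ := 1), jacobiSym.one_left]
    rw [show (4 * a : ℤ) = 1 + ((4 * a - 1 : ℕ) : ℤ) by lia, Int.add_emod_right]
  rwa [jacobiSym.mul_left, jacobiSym.at_four hodd, one_mul] at h

/-- For negative `n`, `|n| (4a - 1) ≡ n` modulo `4a`, and the extra factor `4a - 1` has symbol 1. So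
the periodicity of the Jacobi symbol in positive denominators extends across zero. -/
theorem jacobiSym_natAbs_eq_emod {a : ℕ} (ha : 0 < a) {n : ℤ} (hn : Odd n) :
    J(a | n.natAbs) = J(a | (n % (4 * a)).toNat) := by
  have hodd := Int.natAbs_odd.2 hn
  rcases lt_or_ge n 0 with h | h
  · have ho4 : Odd (4 * a - 1) := by rw [Nat.odd_iff]; lia
    have h1 : J(a | n.natAbs) = J(a | n.natAbs * (4 * a - 1)) := by
      rw [jacobiSym.mul_right' _ hodd.pos.ne' (by lia), jacobiSym_four_mul_sub_one ha, mul_one]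
    rw [h1, jacobiSym.mod_right' a (hodd.mul ho4)]
    congr 1
    zify
    rw [Int.toNat_of_nonneg (Int.emod_nonneg _ (by lia))]
    apply Int.ModEq.symm
    rw [Int.modEq_iff_dvd]
    refine ⟨-n, ?_⟩
    rw [show ((4 * a - 1 : ℕ) : ℤ) = 4 * a - 1 by lia, abs_of_neg h]
    ring
  · lift n to ℕ using h
    rw [Int.natAbs_natCast, jacobiSym.mod_right' a (by simpa using hodd)]
    congr 1

theorem kroneckerSym_periodic {a n : ℤ} (hn : Odd n) (m : ℤ) :
    kroneckerSym a (n + 4 * a * m) = kroneckerSym a n := by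
  have hn' (b : ℤ) : Odd (n + 4 * b) := hn.add_even ⟨2 * b, by ring⟩
  have key (b : ℕ) (hb : 0 < b) (m : ℤ) :
      kroneckerSym b (n + 4 * b * m) = kroneckerSym b n := by
    have h1 : Odd (n + 4 * b * m) := by rw [mul_assoc]; exact hn' _
    rw [kroneckerSym_of_odd_of_nonneg_left h1 (by lia),
      kroneckerSym_of_odd_of_nonneg_left hn (by lia), jacobiSym_natAbs_eq_emod hb h1,
      jacobiSym_natAbs_eq_emod hb hn]
    simp
  rcases lt_trichotomy a 0 with h | rfl | h
  · obtain ⟨b, hb⟩ := Int.eq_ofNat_of_zero_le (by lia : 0 ≤ -a)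
    obtain rfl : a = -1 * b := by lia
    have h1 : Odd (n + 4 * (-1 * b) * m) := by rw [mul_assoc]; exact hn' _
    rw [kroneckerSym_mul_left h1 (by lia) (by lia), kroneckerSym_mul_left hn (by lia) (by lia),
      kroneckerSym_neg_one h1, kroneckerSym_neg_one hn,
      show n + 4 * (-1 * (b : ℤ)) * m = n + 4 * b * (-m) by ring, key b (by lia)]
    congr 2
    push_cast
    rw [show (4 : ZMod 4) = 0 from rfl]
    ring
  · simp
  · lift a to ℕ using h.le
    exact key a (by lia) m

theorem kroneckerSym_emod_left {a b n : ℤ} (hn : Odd n) (h0 : 0 < n) (h : a ≡ b [ZMOD n]) :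
    kroneckerSym a n = kroneckerSym b n := by
  rw [kroneckerSym_of_odd_of_pos hn h0, kroneckerSym_of_odd_of_pos hn h0]
  apply jacobiSym.mod_left'
  rwa [show ((n.natAbs : ℕ) : ℤ) = n by lia]

theorem χ₈_neg (x : ZMod 8) : ZMod.χ₈ (-x) = ZMod.χ₈ x := by revert x; decide

/-- For odd `k`, the Kronecker symbol of `(-1)^((k-1)/2) k` is the Jacobi symbol with
denominator `k`. -/
theorem kroneckerSym_prime_disc {k : ℕ} (hk : Odd k) (d : ℤ) :
    kroneckerSym ((-1) ^ ((k - 1) / 2) * k) d = J(d | k) := by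
  have hk0 : 0 < k := hk.pos
  have hexp : (k - 1) / 2 = k / 2 := by obtain ⟨m, rfl⟩ := hk; lia
  have hsign : ((-1 : ℤ) ^ ((k - 1) / 2)) = ZMod.χ₄ k := by
    rw [hexp, ← ZMod.χ₄_eq_neg_one_pow (Nat.odd_iff.1 hk)]
  rcases eq_or_ne d 0 with rfl | hd
  · rcases eq_or_ne k 1 with rfl | hk1
    · simp [kroneckerSym]
    · rw [jacobiSym.zero_left (by lia), kroneckerSym, if_pos rfl, if_neg]
      rcases neg_one_pow_eq_or ℤ ((k - 1) / 2) with h | h <;> rw [h] <;> lia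
  have hodd (m : ℕ) (hm : Odd m) : J((-1) ^ ((k - 1) / 2) * k | m) = J(m | k) := by
    rw [hsign]
    rcases Nat.odd_mod_four_iff.mp (Nat.odd_iff.mp hk) with h | h
    · rw [ZMod.χ₄_nat_one_mod_four h, one_mul, jacobiSym.quadratic_reciprocity_one_mod_four h hm]
    · rw [ZMod.χ₄_nat_three_mod_four h, neg_one_mul, jacobiSym.neg _ hm]
      rcases Nat.odd_mod_four_iff.mp (Nat.odd_iff.mp hm) with h' | h'
      · rw [ZMod.χ₄_nat_one_mod_four h', one_mul,
          jacobiSym.quadratic_reciprocity_one_mod_four' hk h']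
      · rw [ZMod.χ₄_nat_three_mod_four h', jacobiSym.quadratic_reciprocity_three_mod_four h h',
          neg_one_mul, neg_neg]
  have hχ : ZMod.χ₈ (((-1) ^ ((k - 1) / 2) * k : ℤ) : ZMod 8) = J(2 | k) := by
    rw [jacobiSym.at_two hk]
    rcases neg_one_pow_eq_or ℤ ((k - 1) / 2) with h | h <;> rw [h]
    · simp
    · rw [neg_one_mul, Int.cast_neg, χ₈_neg, Int.cast_natCast]
  -- The power of 2 in `d` is matched through `χ₈`, the odd part through reciprocity; the sign of
  -- `d` is treated last.
  have habs : J(d.natAbs | k) = ZMod.χ₈ (((-1) ^ ((k - 1) / 2) * k : ℤ) : ZMod 8)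
      ^ d.natAbs.factorization 2 *
      J((-1) ^ ((k - 1) / 2) * k | d.natAbs / 2 ^ d.natAbs.factorization 2) := by
    have ho : Odd (d.natAbs / 2 ^ d.natAbs.factorization 2) := by
      rw [← Nat.not_even_iff_odd, even_iff_two_dvd]
      exact Nat.not_dvd_ordCompl Nat.prime_two (by lia)
    rw [hχ, hodd _ ho, ← jacobiSym.pow_left, ← jacobiSym.mul_left]
    congr 1
    exact_mod_cast (Nat.ordProj_mul_ordCompl_eq_self d.natAbs 2).symm
  rw [kroneckerSym, if_neg hd, mul_assoc, ← habs]
  rcases lt_or_ge d 0 with h | h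
  · have hd' : J(d | k) = ZMod.χ₄ k * J(d.natAbs | k) := by
      rw [← jacobiSym.neg _ hk, show -((d.natAbs : ℕ) : ℤ) = d by lia]
    rw [hd', ← hsign]
    congr 1
    rcases neg_one_pow_eq_or ℤ ((k - 1) / 2) with h' | h' <;> rw [h']
    · rw [if_neg (by lia)]
    · rw [if_pos (by lia)]
  · rw [if_neg (by lia), one_mul, Int.natAbs_of_nonneg h]

/-- The Jacobi symbol with denominator `k`, as a Dirichlet character modulo `k`. -/
def jacobiChar (k : ℕ) [NeZero k] : DirichletCharacter ℂ k where
  toFun x := (J((x.val : ℤ) | k) : ℂ)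
  map_one' := by
    suffices h : J(((1 : ZMod k).val : ℤ) | k) = 1 by rw [h, Int.cast_one]
    rw [← jacobiSym.one_left k]
    apply jacobiSym.mod_left'
    rcases eq_or_ne k 1 with rfl | h
    · simp
    · rw [ZMod.val_one'' h]; rfl
  map_mul' x y := by
    rw [← Int.cast_mul, ← jacobiSym.mul_left, ZMod.val_mul]
    congr 1
    apply jacobiSym.mod_left'
    push_cast
    simp
  map_nonunit' x hx := by
    rw [Int.cast_eq_zero, jacobiSym.eq_zero_iff]
    refine ⟨NeZero.ne k, fun h => hx ?_⟩
    rw [← ZMod.natCast_zmod_val x]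
    exact (ZMod.isUnit_iff_coprime _ _).2 (by rwa [Int.gcd, Int.natAbs_natCast, Int.natAbs_natCast] at h)

theorem jacobiChar_intCast (k : ℕ) [NeZero k] (d : ℤ) : jacobiChar k (d : ZMod k) = (J(d | k) : ℂ) := by
  change (J((((d : ZMod k).val : ℕ) : ℤ) | k) : ℂ) = _
  rw [ZMod.val_intCast, ← jacobiSym.mod_left]

/-- The Kronecker symbol of `4 * a` as a Dirichlet character modulo `4 * a`, for `0 < a`. -/
def kroneckerChar (a : ℕ) [NeZero a] : DirichletCharacter ℂ (4 * a) where
  toFun x := if Even x.val then 0 else (J(a | x.val) : ℂ)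
  map_one' := by
    have : a ≠ 0 := NeZero.ne a
    rw [ZMod.val_one'' (by lia)]
    simp
  map_mul' x y := by
    have : a ≠ 0 := NeZero.ne a
    have hpar : Even (x * y).val ↔ Even x.val ∨ Even y.val := by
      rw [ZMod.val_mul, ← Nat.even_mul, Nat.even_iff, Nat.even_iff,
        Nat.mod_mod_of_dvd _ ⟨2 * a, by ring⟩]
    by_cases hx : Even x.val
    · simp [hpar, hx]
    by_cases hy : Even y.val
    · simp [hpar, hy]
    rw [if_neg hx, if_neg hy, if_neg (by tauto), ZMod.val_mul]
    rw [Nat.not_even_iff_odd] at hx hy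
    rw [← jacobiSym.mod_right' a (hx.mul hy), jacobiSym.mul_right' _ hx.pos.ne' hy.pos.ne']
    push_cast
    rfl
  map_nonunit' x hx := by
    have : a ≠ 0 := NeZero.ne a
    split_ifs with h
    · rfl
    rw [Nat.not_even_iff_odd] at h
    rw [Int.cast_eq_zero, jacobiSym.eq_zero_iff]
    refine ⟨h.pos.ne', fun h' => hx ?_⟩
    rw [← ZMod.natCast_zmod_val x, ZMod.isUnit_iff_coprime]
    refine Nat.Coprime.mul_right ?_ (by rwa [Int.gcd, Int.natAbs_natCast, Int.natAbs_natCast, Nat.gcd_comm] at h')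
    exact Nat.Coprime.pow_right 2 (Nat.coprime_two_right.2 h)

/-- Applied with `k = 2a`, so that `4a = 2k` is both the upper entry of the symbol and the level. -/
theorem kroneckerChar_intCast (a : ℕ) [NeZero a] (d : ℤ) :
    kroneckerChar a (d : ZMod (4 * a)) = (kroneckerSym (4 * a) d : ℂ) := by
  have ha : a ≠ 0 := NeZero.ne a
  have hv : (((d : ZMod (4 * a)).val : ℕ) : ℤ) = d % (4 * a) := by rw [ZMod.val_intCast]; push_cast; rfl
  change (if Even (d : ZMod (4 * a)).val then 0 else (J(a | (d : ZMod (4 * a)).val) : ℂ)) = _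
  have hpar : Even (d : ZMod (4 * a)).val ↔ Even d := by
    rw [← Int.even_coe_nat, hv, Int.even_iff, Int.even_iff, Int.emod_emod_of_dvd _ ⟨2 * a, by ring⟩]
  by_cases hd : Even d
  · rw [if_pos (hpar.2 hd), eq_comm, Int.cast_eq_zero]
    rcases eq_or_ne d 0 with rfl | hd0
    · rw [kroneckerSym, if_pos rfl, if_neg (by lia)]
    · have h1 : d.natAbs.factorization 2 ≠ 0 := by
        have := (Nat.prime_two.dvd_iff_one_le_factorization (by lia : d.natAbs ≠ 0)).1
          (Int.natAbs_even.2 hd).two_dvd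
        lia
      have h2 : ZMod.χ₈ ((4 * a : ℤ) : ZMod 8) = 0 := by
        push_cast
        generalize (a : ZMod 8) = x
        revert x; decide
      rw [kroneckerSym, h2, zero_pow h1]
      simp [hd0]
  · rw [if_neg (by tauto)]
    rw [Int.not_even_iff_odd] at hd
    rw [kroneckerSym_four_mul hd, kroneckerSym_of_odd_of_nonneg_left hd (by lia),
      jacobiSym_natAbs_eq_emod (by lia) hd, ← hv, Int.toNat_natCast]

open Complex

/-! ### Principal square roots -/

theorem cpow_half_sq (z : ℂ) : (z ^ (1 / 2 : ℂ)) ^ 2 = z := by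
  rw [← cpow_nat_mul]; simp

theorem cpow_half_ne_zero {z : ℂ} (hz : z ≠ 0) : z ^ (1 / 2 : ℂ) ≠ 0 := by
  rw [Ne, cpow_eq_zero_iff]; tauto

theorem mul_cpow_half {x y : ℂ} (hx : x ≠ 0) (hy : y ≠ 0)
    (h : x.arg + y.arg ∈ Set.Ioc (-Real.pi) Real.pi) :
    (x * y) ^ (1 / 2 : ℂ) = x ^ (1 / 2 : ℂ) * y ^ (1 / 2 : ℂ) := by
  rw [cpow_def_of_ne_zero (mul_ne_zero hx hy), cpow_def_of_ne_zero hx, cpow_def_of_ne_zero hy,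
    (log_mul_eq_add_log_iff hx hy).2 h, add_mul, exp_add]

theorem im_mul_eq_sin_arg (x y : ℂ) : (x * y).im = ‖x‖ * ‖y‖ * Real.sin (x.arg + y.arg) := by
  rw [Real.sin_add, mul_im]
  have h1 := norm_mul_cos_arg x
  have h2 := norm_mul_sin_arg x
  have h3 := norm_mul_cos_arg y
  have h4 := norm_mul_sin_arg y
  rw [← h1, ← h2, ← h3, ← h4]
  ring

/-- If the sum of the arguments exceeded `π`, it would lie in `(π, 2π)`, where the sine is negative,
contradicting the sign of the imaginary part of the product. -/
theorem mul_cpow_half_of_im_pos {x y : ℂ} (hy : 0 < y.im) (hxy : 0 < (x * y).im) :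
    (x * y) ^ (1 / 2 : ℂ) = x ^ (1 / 2 : ℂ) * y ^ (1 / 2 : ℂ) := by
  have hy0 : y ≠ 0 := by rintro rfl; simp at hy
  have hx0 : x ≠ 0 := by rintro rfl; simp at hxy
  have h1 : 0 < y.arg := (arg_nonneg_iff.2 hy.le).lt_of_ne' fun h => by
    rw [arg_eq_zero_iff] at h; exact hy.ne' h.2
  have h2 := neg_pi_lt_arg x
  refine mul_cpow_half hx0 hy0 ⟨by linarith, ?_⟩
  by_contra! h
  have h3 : y.arg < Real.pi := arg_lt_pi_iff.2 (Or.inr hy.ne')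
  have h4 := arg_le_pi x
  have h5 : Real.sin (x.arg + y.arg - 2 * Real.pi) < 0 :=
    Real.sin_neg_of_neg_of_neg_pi_lt (by linarith) (by linarith)
  rw [Real.sin_sub_two_pi] at h5
  rw [im_mul_eq_sin_arg] at hxy
  have := mul_nonneg (norm_nonneg x) (norm_nonneg y)
  nlinarith

theorem mul_cpow_half_of_im_neg {x y : ℂ} (hy : y.im < 0) (hxy : (x * y).im < 0) :
    (x * y) ^ (1 / 2 : ℂ) = x ^ (1 / 2 : ℂ) * y ^ (1 / 2 : ℂ) := by
  have hy0 : y ≠ 0 := by rintro rfl; simp at hy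
  have hx0 : x ≠ 0 := by rintro rfl; simp at hxy
  have h1 : y.arg < 0 := arg_neg_iff.2 hy
  have h2 := arg_le_pi x
  refine mul_cpow_half hx0 hy0 ⟨?_, by linarith⟩
  by_contra! h
  have h3 := neg_pi_lt_arg y
  have h4 := neg_pi_lt_arg x
  have h5 : 0 ≤ Real.sin (x.arg + y.arg + 2 * Real.pi) :=
    Real.sin_nonneg_of_nonneg_of_le_pi (by linarith) (by linarith)
  rw [Real.sin_add_two_pi] at h5
  rw [im_mul_eq_sin_arg] at hxy
  have := mul_nonneg (norm_nonneg x) (norm_nonneg y)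
  nlinarith

theorem neg_one_cpow_half : (-1 : ℂ) ^ (1 / 2 : ℂ) = I := by
  rw [cpow_def_of_ne_zero (by norm_num), log_neg_one, show Real.pi * I * (1 / 2) = Real.pi / 2 * I by ring,
    exp_pi_div_two_mul_I]

theorem cpow_half_eq_I_mul_of_im_pos {x : ℂ} (hx : 0 < x.im) :
    x ^ (1 / 2 : ℂ) = I * (-x) ^ (1 / 2 : ℂ) := by
  have hx0 : -x ≠ 0 := by rw [neg_ne_zero]; rintro rfl; simp at hx
  have h1 : (-x).arg < 0 := arg_neg_iff.2 (by simpa using hx)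
  have h2 := neg_pi_lt_arg (-x)
  conv_lhs => rw [show x = (-1) * (-x) by ring]
  rw [mul_cpow_half (by norm_num) hx0, neg_one_cpow_half]
  rw [arg_neg_one]
  constructor <;> linarith

theorem cpow_half_eq_neg_I_mul_of_im_neg {x : ℂ} (hx : x.im < 0) :
    x ^ (1 / 2 : ℂ) = -I * (-x) ^ (1 / 2 : ℂ) := by
  rw [cpow_half_eq_I_mul_of_im_pos (x := -x) (by simpa using hx), neg_neg, ← mul_assoc,
    neg_mul, I_mul_I, neg_neg, one_mul]

/-! ### Möbius transformations with integer coefficients -/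

theorem int_mul_add_ne_zero {c d : ℤ} (h : IsCoprime c d) {τ : ℂ} (hτ : 0 < τ.im) :
    (c * τ + d : ℂ) ≠ 0 := by
  intro h0
  have him := congrArg im h0
  have hre := congrArg re h0
  simp at him hre
  rcases him with rfl | h1
  · simp at hre
    subst hre
    exact not_isCoprime_zero_zero h
  · exact hτ.ne' h1

theorem isCoprime_of_det {a b c d : ℤ} (h : a * d - b * c = 1) : IsCoprime c d :=
  ⟨-b, a, by linarith⟩

theorem moebius_im_pos {a b c d : ℤ} (h : a * d - b * c = 1) {τ : ℂ} (hτ : 0 < τ.im) :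
    0 < ((a * τ + b) / (c * τ + d) : ℂ).im := by
  have hne := int_mul_add_ne_zero (isCoprime_of_det h) hτ
  have hs : 0 < normSq (c * τ + d) := normSq_pos.2 hne
  have h' : (a * d - b * c : ℝ) = 1 := by exact_mod_cast h
  have : ((a * τ + b) / (c * τ + d) : ℂ).im = τ.im / normSq (c * τ + d) := by
    rw [div_im, ← sub_div]
    congr 1
    simp
    linear_combination τ.im * h'
  rw [this]
  positivity

/-! ### The Jacobi theta function under the principal congruence subgroup of level two -/

theorem jacobiTheta₂_S {τ : ℂ} (hτ : 0 < τ.im) (u : ℂ) :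
    jacobiTheta₂ (u / τ) (-1 / τ) =
      (-I * τ) ^ (1 / 2 : ℂ) * cexp (Real.pi * I * u ^ 2 / τ) * jacobiTheta₂ u τ := by
  have hτ0 : -I * τ ≠ 0 := mul_ne_zero (by simp) (by rintro rfl; simp at hτ)
  have h1 := cpow_half_ne_zero hτ0
  have h2 : cexp (-Real.pi * I * u ^ 2 / τ) = (cexp (Real.pi * I * u ^ 2 / τ))⁻¹ := by
    rw [← exp_neg]; congr 1; ring
  rw [jacobiTheta₂_functional_equation u τ, h2]
  have h3 := exp_ne_zero (Real.pi * I * u ^ 2 / τ)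
  generalize (-I * τ) ^ (1 / 2 : ℂ) = x at h1 ⊢
  field_simp

theorem jacobiTheta₂_add_even (u τ : ℂ) (m : ℤ) :
    jacobiTheta₂ u (τ + 2 * m) = jacobiTheta₂ u τ := by
  have : Function.Periodic (jacobiTheta₂ u) 2 := jacobiTheta₂_add_right u
  rw [mul_comm]
  exact this.int_mul m τ

/-- Conjugate the translation by `-2n` by inversion: the new argument is `-1/σ` with `σ = -1/τ -
2n`. -/
theorem jacobiTheta₂_lower_unipotent {τ : ℂ} (hτ : 0 < τ.im) (u : ℂ) (n : ℤ) :
    jacobiTheta₂ (u / (2 * n * τ + 1)) (τ / (2 * n * τ + 1)) =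
      (2 * n * τ + 1) ^ (1 / 2 : ℂ) * cexp (Real.pi * I * (2 * n) * u ^ 2 / (2 * n * τ + 1)) *
        jacobiTheta₂ u τ := by
  have hτ0 : τ ≠ 0 := by rintro rfl; simp at hτ
  have hJ : (2 * n * τ + 1 : ℂ) ≠ 0 := by
    have := int_mul_add_ne_zero (c := 2 * n) (d := 1) isCoprime_one_right hτ
    push_cast at this; exact this
  have h1 : 0 < (-1 / τ).im := by
    have := moebius_im_pos (a := 0) (b := -1) (c := 1) (d := 0) (by norm_num) hτ
    simpa using this
  set σ : ℂ := -1 / τ - 2 * n with hσ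
  have hσim : 0 < σ.im := by simpa [hσ] using h1
  have hσ0 : σ ≠ 0 := by intro h; rw [h] at hσim; simp at hσim
  have hστ : σ * τ = -(2 * n * τ + 1) := by rw [hσ]; field_simp; ring
  have e1 : u / (2 * n * τ + 1) = (-(u / τ)) / σ := by
    rw [div_eq_div_iff hJ hσ0]; field_simp; linear_combination u * hστ
  have e2 : τ / (2 * n * τ + 1) = -1 / σ := by
    rw [div_eq_div_iff hJ hσ0]; linear_combination hστ
  have e3 : jacobiTheta₂ (-(u / τ)) σ = jacobiTheta₂ (u / τ) (-1 / τ) := by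
    rw [jacobiTheta₂_neg_left, ← jacobiTheta₂_add_even _ σ n, hσ, sub_add_cancel]
  -- Both `-iσ` and `-iτ` lie in the right half-plane, so the roots multiply without a sign.
  have e4 : (2 * n * τ + 1 : ℂ) ^ (1 / 2 : ℂ) =
      (-I * σ) ^ (1 / 2 : ℂ) * (-I * τ) ^ (1 / 2 : ℂ) := by
    have h2 : (2 * n * τ + 1 : ℂ) = (-I * σ) * (-I * τ) := by
      linear_combination hστ - σ * τ * I_sq
    have key (z : ℂ) (hz : 0 < z.im) : |(-I * z).arg| < Real.pi / 2 :=
      abs_arg_lt_pi_div_two_iff.2 (Or.inl (by simpa using hz))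
    have k1 := abs_lt.1 (key σ hσim)
    have k2 := abs_lt.1 (key τ hτ)
    rw [h2, mul_cpow_half (by simp [hσ0]) (by simp [hτ0])]
    constructor <;> linarith
  rw [e1, e2, jacobiTheta₂_S hσim, e3, jacobiTheta₂_S hτ, e4]
  have e5 : cexp (Real.pi * I * (2 * n) * u ^ 2 / (2 * n * τ + 1)) =
      cexp (Real.pi * I * (-(u / τ)) ^ 2 / σ) * cexp (Real.pi * I * u ^ 2 / τ) := by
    rw [← exp_add]
    congr 1
    have : (2 * n * τ + 1 : ℂ) = - (σ * τ) := by rw [hστ, neg_neg]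
    rw [this, hσ]
    rw [hσ] at hσ0
    have h0 : (-1 - 2 * n * τ : ℂ) ≠ 0 := by
      intro h; apply hJ; linear_combination -h
    field_simp
    ring
  rw [e5]
  ring

/-- The multiplier of the Jacobi theta function under `Γ(2)`. -/
def thetaMult (c d : ℤ) : ℂ := (kroneckerSym (2 * c) d : ℂ) * (eps d)⁻¹

theorem thetaMult_zero_one : thetaMult 0 1 = 1 := by
  simp [thetaMult, eps, kroneckerSym]

theorem eps_of_emod_one {d : ℤ} (h : d % 4 = 1) : eps d = 1 := by simp [eps, h]

theorem eps_of_emod_three {d : ℤ} (h : d % 4 = 3) : eps d = I := by simp [eps, h]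

theorem eps_ne_zero (d : ℤ) : eps d ≠ 0 := by unfold eps; split_ifs <;> simp

theorem thetaMult_add_right {c d : ℤ} (hc : Even c) (hd : Odd d) (m : ℤ) :
    thetaMult c (d + 2 * c * m) = thetaMult c d := by
  obtain ⟨e, rfl⟩ := hc
  have h1 : d + 2 * (e + e) * m = d + 4 * e * m := by ring
  have h2 : Odd (d + 4 * e * m) := hd.add_even ⟨2 * e * m, by ring⟩
  have h3 : (d + 4 * e * m) % 4 = d % 4 := by rw [mul_assoc]; simp
  rw [h1, thetaMult, thetaMult, show 2 * (e + e) = 4 * e by ring, kroneckerSym_four_mul h2,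
    kroneckerSym_four_mul hd, kroneckerSym_periodic hd, eps, eps, h3]

theorem thetaMult_add_left {c d : ℤ} (hd : Odd d) (h0 : 0 < d) (m : ℤ) :
    thetaMult (c + 2 * d * m) d = thetaMult c d := by
  rw [thetaMult, thetaMult, kroneckerSym_emod_left hd h0 (b := 2 * c)]
  rw [Int.modEq_iff_dvd]
  exact ⟨-4 * m, by ring⟩

/-- Here `s` is the ratio of the principal roots of `cτ + d` and `-(cτ + d)`; its dependence on the
sign of `c` cancels the sign rule of the Kronecker symbol at negative `d`. -/
theorem thetaMult_neg {c d : ℤ} (hd : Odd d) (h0 : d < 0) {s : ℂ}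
    (hs : 0 ≤ c ∧ s = I ∨ c < 0 ∧ s = -I) :
    thetaMult c d * s = thetaMult (-c) (-d) := by
  have hd' : Odd (-d) := hd.neg
  have hdn : Odd d.natAbs := Int.natAbs_odd.2 hd
  have e1 : thetaMult c d * s = (jacobiSym (2 * c) d.natAbs : ℂ) * (eps d)⁻¹ * I := by
    rw [thetaMult, kroneckerSym_of_odd hd]
    rcases hs with ⟨hc, rfl⟩ | ⟨hc, rfl⟩
    · rw [if_neg (by lia)]; push_cast; ring
    · rw [if_pos (by lia)]; push_cast; ring
  rw [e1, thetaMult, kroneckerSym_of_odd_of_pos hd' (by lia), Int.natAbs_neg, mul_neg,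
    jacobiSym.neg _ hdn]
  rcases Nat.odd_mod_four_iff.mp (Nat.odd_iff.mp hdn) with h | h
  · rw [ZMod.χ₄_nat_one_mod_four h, eps_of_emod_three (d := d) (by lia),
      eps_of_emod_one (d := -d) (by lia), mul_assoc, inv_mul_cancel₀ I_ne_zero]
    simp
  · rw [ZMod.χ₄_nat_three_mod_four h, eps_of_emod_one (d := d) (by lia),
      eps_of_emod_three (d := -d) (by lia)]
    simp

/-- The transformation law of the Jacobi theta function under the matrix with entries
`a b c d`. -/
def JacobiLaw (a b c d : ℤ) : Prop :=
  ∀ τ : ℂ, 0 < τ.im → ∀ u : ℂ,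
    jacobiTheta₂ (u / (c * τ + d)) ((a * τ + b) / (c * τ + d)) =
      thetaMult c d * (c * τ + d) ^ (1 / 2 : ℂ) *
        cexp (Real.pi * I * c * u ^ 2 / (c * τ + d)) * jacobiTheta₂ u τ

theorem JacobiLaw.of_neg {a b c d : ℤ} (hdet : a * d - b * c = 1) (hd : Odd d) (h0 : d < 0)
    (h : JacobiLaw (-a) (-b) (-c) (-d)) : JacobiLaw a b c d := by
  intro τ hτ u
  have hJ := int_mul_add_ne_zero (isCoprime_of_det hdet) hτ
  have h1 := h τ hτ (-u)
  have e0 : ((-c : ℤ) * τ + (-d : ℤ) : ℂ) = -(c * τ + d) := by push_cast; ring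
  have e1 : ((-a : ℤ) * τ + (-b : ℤ) : ℂ) = -(a * τ + b) := by push_cast; ring
  rw [e0, e1, neg_div_neg_eq, neg_div_neg_eq, jacobiTheta₂_neg_left] at h1
  have e2 : Real.pi * I * ((-c : ℤ) : ℂ) * (-u) ^ 2 / -(c * τ + d) =
      Real.pi * I * c * u ^ 2 / (c * τ + d) := by
    push_cast; rw [← neg_div_neg_eq, neg_neg]; ring_nf
  rw [e2] at h1
  rw [h1]
  congr 2
  rcases lt_trichotomy c 0 with hc | rfl | hc
  · rw [← thetaMult_neg hd h0 (Or.inr ⟨hc, rfl⟩),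
      cpow_half_eq_neg_I_mul_of_im_neg (x := c * τ + d), mul_assoc]
    simp only [add_im, mul_im, intCast_re, intCast_im, zero_mul, add_zero]
    exact mul_neg_of_neg_of_pos (by exact_mod_cast hc) hτ
  · have : d = -1 := by
      rw [mul_zero, sub_zero] at hdet
      rcases Int.isUnit_iff.1 (IsUnit.of_mul_eq_one _ (by rwa [mul_comm] at hdet)) with h | h <;> lia
    subst this
    rw [← thetaMult_neg hd h0 (Or.inl ⟨le_rfl, rfl⟩)]
    have e3 : ((0 : ℤ) * τ + (-1 : ℤ) : ℂ) = -1 := by simp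
    rw [e3, neg_one_cpow_half, mul_assoc]
    simp
  · rw [← thetaMult_neg hd h0 (Or.inl ⟨hc.le, rfl⟩),
      cpow_half_eq_I_mul_of_im_pos (x := c * τ + d), mul_assoc]
    simp only [add_im, mul_im, intCast_re, intCast_im, zero_mul, add_zero]
    exact mul_pos (by exact_mod_cast hc) hτ

theorem JacobiLaw.of_mul_T {a b c d : ℤ} (hc : Even c) (hd : Odd d) (m : ℤ)
    (h : JacobiLaw a (b + 2 * a * m) c (d + 2 * c * m)) : JacobiLaw a b c d := by
  intro τ hτ u
  have h1 := h (τ - 2 * m) (by simpa using hτ) u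
  have e0 : (c * (τ - 2 * m) + ((d + 2 * c * m : ℤ) : ℂ)) = c * τ + d := by push_cast; ring
  have e1 : (a * (τ - 2 * m) + ((b + 2 * a * m : ℤ) : ℂ)) = a * τ + b := by push_cast; ring
  rw [e0, e1, thetaMult_add_right hc hd] at h1
  rw [h1, ← jacobiTheta₂_add_even u (τ - 2 * m) m, sub_add_cancel]

/-- The matrix is multiplied on the right by `(1, 0; 2m, 1)`. As `c` and `m` have opposite signs,
`cτ + d` and `-2mτ + 1` lie in the same half-plane, and the principal roots multiply. -/
theorem JacobiLaw.of_mul_U {a b c d : ℤ} (hdet : a * d - b * c = 1) (hd : Odd d) (h0 : 0 < d)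
    (m : ℤ) (hm : 0 < c ∧ m < 0 ∨ c < 0 ∧ 0 < m)
    (h : JacobiLaw (a + 2 * b * m) b (c + 2 * d * m) d) : JacobiLaw a b c d := by
  intro τ hτ u
  have hB : (2 * (-m : ℤ) * τ + 1 : ℂ) ≠ 0 := by
    have := int_mul_add_ne_zero (c := 2 * (-m)) (d := 1) isCoprime_one_right hτ
    push_cast at this ⊢; exact this
  have hJ := int_mul_add_ne_zero (isCoprime_of_det hdet) hτ
  have him : 0 < (τ / (2 * (-m : ℤ) * τ + 1)).im := by
    have := moebius_im_pos (a := 1) (b := 0) (c := 2 * (-m)) (d := 1) (by ring) hτ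
    simpa using this
  have h1 := h _ him (u / (2 * (-m : ℤ) * τ + 1))
  rw [jacobiTheta₂_lower_unipotent hτ, thetaMult_add_left hd h0] at h1
  set B : ℂ := 2 * (-m : ℤ) * τ + 1 with hBdef
  have e0 : ((c + 2 * d * m : ℤ) : ℂ) * (τ / B) + d = (c * τ + d) / B := by
    field_simp
    rw [hBdef]; push_cast; ring
  have e1 : ((a + 2 * b * m : ℤ) : ℂ) * (τ / B) + b = (a * τ + b) / B := by
    field_simp
    rw [hBdef]; push_cast; ring
  rw [e0, e1, div_div_div_cancel_right₀ hB, div_div_div_cancel_right₀ hB] at h1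
  have hAB : (c * τ + d) / B * B = c * τ + d := div_mul_cancel₀ _ hB
  have e2 : (c * τ + d) ^ (1 / 2 : ℂ) = ((c * τ + d) / B) ^ (1 / 2 : ℂ) * B ^ (1 / 2 : ℂ) := by
    have imB : B.im = -2 * m * τ.im := by rw [hBdef]; simp
    have imJ : (c * τ + d : ℂ).im = c * τ.im := by simp
    rcases hm with ⟨hc, hm⟩ | ⟨hc, hm⟩
    · have hc' : (0 : ℝ) < c := by exact_mod_cast hc
      have hm' : (m : ℝ) < 0 := by exact_mod_cast hm
      rw [← mul_cpow_half_of_im_pos, hAB]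
      · rw [imB]; nlinarith
      · rw [hAB, imJ]; positivity
    · have hc' : (c : ℝ) < 0 := by exact_mod_cast hc
      have hm' : (0 : ℝ) < m := by exact_mod_cast hm
      rw [← mul_cpow_half_of_im_neg, hAB]
      · rw [imB]; nlinarith
      · rw [hAB, imJ]; nlinarith
  rw [h1, e2]
  have e3 : cexp (Real.pi * I * c * u ^ 2 / (c * τ + d)) =
      cexp (Real.pi * I * ((c + 2 * d * m : ℤ) : ℂ) * (u / B) ^ 2 / ((c * τ + d) / B)) *
      cexp (Real.pi * I * (2 * (-m : ℤ)) * u ^ 2 / B) := by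
    rw [← exp_add]
    congr 1
    field_simp
    rw [hBdef]; push_cast; ring
  rw [e3]
  ring

/-- Euclid's algorithm with even steps on the bottom row: `c` is even and `d` odd, so `|c| ≠ |d|`,
and for `c ≠ 0` adding `±2` times the smaller entry to the larger one lowers `|c| + |d|`. -/
theorem jacobiLaw_of_even {a b c d : ℤ} (hdet : a * d - b * c = 1) (hb : Even b) (hc : Even c) :
    JacobiLaw a b c d := by
  induction hn : c.natAbs + d.natAbs using Nat.strong_induction_on generalizing a b c d with
  | _ n ih =>
  have hodd {a b c d : ℤ} (hdet : a * d - b * c = 1) (hc : Even c) : Odd d := by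
    have : Odd (a * d) := by
      rw [show a * d = b * c + 1 by lia]; exact (hc.mul_left b).add_one
    exact (Int.odd_mul.1 this).2
  have main {a b c d : ℤ} (hdet : a * d - b * c = 1) (hb : Even b) (hc : Even c)
      (hn : c.natAbs + d.natAbs = n) (h0 : 0 < d) : JacobiLaw a b c d := by
    have hd := hodd hdet hc
    rcases eq_or_ne c 0 with rfl | hc0
    · have : d = 1 := by
        rw [mul_zero, sub_zero] at hdet
        rcases Int.isUnit_iff.1 (IsUnit.of_mul_eq_one _ (by rwa [mul_comm] at hdet)) with h | h <;> lia
      subst this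
      obtain rfl : a = 1 := by lia
      obtain ⟨m, rfl⟩ := hb
      intro τ hτ u
      have := jacobiTheta₂_add_even u τ m
      simp only [Int.cast_zero, zero_mul, zero_add, Int.cast_one, div_one, one_mul,
        thetaMult_zero_one, one_cpow, mul_zero, exp_zero]
      rw [← this]; congr 1; push_cast; ring
    have hne : c.natAbs ≠ d.natAbs := by
      intro h
      have h1 : Even c.natAbs := Int.natAbs_even.2 hc
      have h2 : Odd d.natAbs := Int.natAbs_odd.2 hd
      rw [h, ← Nat.not_odd_iff_even] at h1
      exact h1 h2
    rcases lt_or_gt_of_ne hne with hlt | hlt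
    · rcases lt_or_gt_of_ne hc0 with hneg | hpos
      · exact .of_mul_T hc hd 1 (ih _ (by lia) (by linarith) (hb.add (by simp)) hc rfl)
      · exact .of_mul_T hc hd (-1) (ih _ (by lia) (by linarith) (hb.add (by simp)) hc rfl)
    · rcases lt_or_gt_of_ne hc0 with hneg | hpos
      · exact .of_mul_U hdet hd h0 1 (by lia)
          (ih _ (by lia) (by linarith) hb (hc.add (by simp)) rfl)
      · exact .of_mul_U hdet hd h0 (-1) (by lia)
          (ih _ (by lia) (by linarith) hb (hc.add (by simp)) rfl)
  have hd := hodd hdet hc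
  rcases lt_or_ge 0 d with h | h
  · exact main hdet hb hc hn h
  · have h0 : d < 0 := lt_of_le_of_ne h (by rintro rfl; simp at hd)
    exact .of_neg hdet hd h0 (main (by linarith) hb.neg hc.neg (by lia) (by lia))

/-! ### Sums over products -/

theorem hasSum_of_eq {ι : Type*} {f g : ι → ℂ} {a : ℂ} (h : HasSum f a) (e : ∀ i, g i = f i) :
    HasSum g a := by
  rwa [funext e]

theorem hasSum_pi_prod {f : ℤ → ℂ} (hf : Summable fun i => ‖f i‖) (n : ℕ) :
    HasSum (fun x : Fin n → ℤ => ∏ i, f (x i)) ((∑' i, f i) ^ n) ∧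
      Summable fun x : Fin n → ℤ => ‖∏ i, f (x i)‖ := by
  induction n with
  | zero => simp [hasSum_unique, Summable.of_finite]
  | succ n ih =>
    set g : (Fin n → ℤ) → ℂ := fun x => ∏ i, f (x i)
    have h1 := hf.of_norm.hasSum.mul ih.1 (summable_mul_of_summable_norm (g := g) hf ih.2)
    have h2 := Summable.mul_norm (g := g) hf ih.2
    have e : (fun x : Fin (n + 1) → ℤ => ∏ i, f (x i)) ∘ (Fin.consEquiv fun _ => ℤ) =
        fun p : ℤ × (Fin n → ℤ) => f p.1 * g p.2 := by
      funext p
      simp [g, Fin.consEquiv, Fin.prod_univ_succ]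
    rw [← e] at h1
    constructor
    · rw [pow_succ']
      exact (Equiv.hasSum_iff _).1 h1
    · refine (Equiv.summable_iff (Fin.consEquiv fun _ => ℤ)).1 ?_
      refine (summable_congr fun p => ?_).2 h2
      exact congrArg norm (congrFun e p)

/-! ### Theta series of the cosets of the root lattice in its dual -/

/-- The squared norm of the vector `(m, s - ∑ mᵢ)` with coordinate sum `s`. -/
def sqSum {r : ℕ} (s : ℤ) (m : Fin r → ℤ) : ℤ := ∑ i, m i ^ 2 + (s - ∑ i, m i) ^ 2

/-- The theta series of a coset of the root lattice `A_r` in its dual lattice. -/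
def cosetTheta (r : ℕ) (s : ℤ) (τ : ℂ) : ℂ :=
  ∑' m : Fin r → ℤ, cexp (Real.pi * I * τ * (sqSum s m - s ^ 2 / (r + 1)))

/-- The theta functions of index `k = r + 1` in one elliptic variable. -/
def indexTheta (r : ℕ) (t : ℤ) (τ u : ℂ) : ℂ :=
  cexp (Real.pi * I * τ * t ^ 2 / (r + 1) + 2 * Real.pi * I * t * u) *
    jacobiTheta₂ ((r + 1) * u + t * τ) ((r + 1) * τ)

/-- Vectors of length `r + 1` as pairs of their coordinate sum and their last `r` coordinates. -/
def sumEquiv (r : ℕ) : ℤ × (Fin r → ℤ) ≃ (Fin (r + 1) → ℤ) where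
  toFun p := Fin.cons (p.1 - ∑ i, p.2 i) p.2
  invFun x := (∑ i, x i, Fin.tail x)
  left_inv p := by ext <;> simp [Fin.sum_univ_succ]
  right_inv x := by
    dsimp only
    rw [Fin.sum_univ_succ]
    simp only [Fin.tail, add_sub_cancel_right]
    exact Fin.cons_self_tail x

theorem hasSum_sqSum (r : ℕ) {τ : ℂ} (hτ : 0 < τ.im) (u : ℂ) :
    HasSum (fun p : ℤ × (Fin r → ℤ) =>
      cexp (Real.pi * I * τ * sqSum p.1 p.2 + 2 * Real.pi * I * p.1 * u))
      (jacobiTheta₂ u τ ^ (r + 1)) := by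
  have h1 := (hasSum_pi_prod ((summable_jacobiTheta₂_term_iff u τ).2 hτ).norm (r + 1)).1
  rw [← (sumEquiv r).hasSum_iff] at h1
  refine hasSum_of_eq h1 fun p => ?_
  simp only [Function.comp_apply, sumEquiv, Equiv.coe_fn_mk, Fin.prod_univ_succ, Fin.cons_zero,
    Fin.cons_succ, jacobiTheta₂_term]
  rw [← exp_sum, ← exp_add]
  congr 1
  rw [Finset.sum_add_distrib, ← Finset.sum_mul, ← Finset.mul_sum, ← Finset.sum_mul,
    ← Finset.mul_sum, sqSum]
  push_cast
  ring

theorem summable_cosetTheta (r : ℕ) (s : ℤ) {τ : ℂ} (hτ : 0 < τ.im) :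
    Summable fun m : Fin r → ℤ => cexp (Real.pi * I * τ * (sqSum s m - s ^ 2 / (r + 1))) := by
  have h1 := ((hasSum_sqSum r hτ 0).summable.prod_factor s).mul_left
    (cexp (-(Real.pi * I * τ * (s ^ 2 / (r + 1)))))
  refine (summable_congr fun m => ?_).2 h1
  rw [← exp_add]
  congr 1
  ring

theorem sqSum_add (r : ℕ) (s : ℤ) (m : Fin r → ℤ) :
    sqSum (s + (r + 1)) (m + 1) = sqSum s m + 2 * s + (r + 1) := by
  simp only [sqSum, Pi.add_apply, Pi.one_apply, add_sq, Finset.sum_add_distrib, ← Finset.mul_sum,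
    ← Finset.sum_mul]
  simp
  ring

theorem natCast_add_one_ne_zero (r : ℕ) : (r + 1 : ℂ) ≠ 0 := by exact_mod_cast r.succ_ne_zero

/-- Adding the all-ones vector shifts the coordinate sum by `r + 1` and preserves the projection to
the sum-zero hyperplane, whose squared norm is the exponent. -/
theorem cosetTheta_periodic (r : ℕ) (τ : ℂ) :
    Function.Periodic (fun s => cosetTheta r s τ) ((r + 1 : ℕ) : ℤ) := by
  intro s
  have hr := natCast_add_one_ne_zero r
  simp only [cosetTheta]
  rw [← (Equiv.addRight (1 : Fin r → ℤ)).tsum_eq]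
  refine tsum_congr fun m => ?_
  congr 2
  push_cast
  rw [Equiv.coe_addRight, sqSum_add]
  push_cast
  field_simp
  ring

theorem indexTheta_periodic (r : ℕ) (τ u : ℂ) :
    Function.Periodic (fun t => indexTheta r t τ u) ((r + 1 : ℕ) : ℤ) := by
  intro t
  have hr := natCast_add_one_ne_zero r
  simp only [indexTheta]
  have e1 : ((r + 1) * u + ((t + (r + 1 : ℕ) : ℤ) : ℂ) * τ : ℂ) =
      ((r + 1) * u + t * τ) + (r + 1) * τ := by push_cast; ring
  rw [e1, jacobiTheta₂_add_left', ← mul_assoc, ← exp_add]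
  congr 2
  push_cast
  field_simp
  ring

theorem hasSum_indexTheta (r : ℕ) {τ : ℂ} (hτ : 0 < τ.im) (u : ℂ) (t : ℤ) :
    HasSum (fun l : ℤ => cexp (Real.pi * I * τ * ((l * (r + 1) + t) ^ 2 / (r + 1)) +
      2 * Real.pi * I * (l * (r + 1) + t) * u)) (indexTheta r t τ u) := by
  have hr := natCast_add_one_ne_zero r
  have him : 0 < ((r + 1) * τ).im := by
    have : ((r + 1) * τ).im = (r + 1) * τ.im := by simp
    rw [this]; positivity
  have h1 := (hasSum_jacobiTheta₂_term ((r + 1) * u + t * τ) him).mul_left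
    (cexp (Real.pi * I * τ * t ^ 2 / (r + 1) + 2 * Real.pi * I * t * u))
  refine hasSum_of_eq h1 fun l => ?_
  rw [jacobiTheta₂_term, ← exp_add]
  congr 1
  field_simp
  ring

/-- The theta decomposition of a power of the Jacobi theta function. -/
theorem jacobiTheta₂_pow_eq (r : ℕ) {τ : ℂ} (hτ : 0 < τ.im) (u : ℂ) :
    jacobiTheta₂ u τ ^ (r + 1) =
      ∑ t : ZMod (r + 1), cosetTheta r t.val τ * indexTheta r t.val τ u := by
  have h1 : HasSum (fun s : ℤ => cosetTheta r s τ *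
      cexp (Real.pi * I * τ * (s ^ 2 / (r + 1)) + 2 * Real.pi * I * s * u))
      (jacobiTheta₂ u τ ^ (r + 1)) := by
    refine (hasSum_sqSum r hτ u).prod_fiberwise fun s => ?_
    refine hasSum_of_eq ((summable_cosetTheta r s hτ).hasSum.mul_right
      (cexp (Real.pi * I * τ * (s ^ 2 / (r + 1)) + 2 * Real.pi * I * s * u))) fun m => ?_
    rw [← exp_add]
    congr 1
    ring
  -- Write `s = l (r + 1) + t`: the coset series depends on `t` only, and the sum over `l` is an
  -- index theta function.
  rw [← ((Equiv.prodComm _ _).trans (Int.divModEquiv (r + 1)).symm).hasSum_iff] at h1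
  have h2 := h1.prod_fiberwise (g := fun t : Fin (r + 1) =>
    cosetTheta r (t : ℕ) τ * indexTheta r (t : ℕ) τ u) fun t => by
      have hp (l : ℤ) : cosetTheta r (l * ((r + 1 : ℕ) : ℤ) + (t : ℕ)) τ =
          cosetTheta r (t : ℕ) τ := by
        rw [add_comm]
        exact (cosetTheta_periodic r τ).int_mul l _
      refine hasSum_of_eq
        ((hasSum_indexTheta r hτ u (t : ℕ)).mul_left (cosetTheta r (t : ℕ) τ)) fun l => ?_
      simp only [Function.comp_apply, Equiv.trans_apply, Equiv.prodComm_apply, Prod.swap,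
        Int.divModEquiv_symm_apply]
      rw [hp]
      push_cast
      rfl
  exact h2.unique (hasSum_fintype _)

/-! ### Sums over residue classes -/

theorem periodic_val_intCast {k : ℕ} [NeZero k] {f : ℤ → ℂ} (hf : Function.Periodic f (k : ℤ))
    (n : ℤ) : f ((n : ZMod k).val : ℤ) = f n := by
  rw [ZMod.val_intCast]
  conv_rhs => rw [← Int.emod_add_mul_ediv n k, mul_comm]
  exact (hf.int_mul _ _).symm

theorem sum_periodic_comp {k : ℕ} [NeZero k] {f : ℤ → ℂ} (hf : Function.Periodic f (k : ℤ))
    (g : ZMod k → ℤ) (hg : Function.Bijective fun x => (g x : ZMod k)) :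
    ∑ x, f (g x) = ∑ x : ZMod k, f x.val := by
  rw [← hg.sum_comp fun x : ZMod k => f x.val]
  exact Finset.sum_congr rfl fun x _ => (periodic_val_intCast hf _).symm

theorem sum_periodic_add {k : ℕ} [NeZero k] {f : ℤ → ℂ} (hf : Function.Periodic f (k : ℤ))
    (c : ℤ) : ∑ x : ZMod k, f (x.val + c) = ∑ x : ZMod k, f x.val := by
  refine sum_periodic_comp hf (fun x => x.val + c) ?_
  simpa using (Equiv.addRight (c : ZMod k)).bijective

theorem sum_periodic_mul {k : ℕ} [NeZero k] {f : ℤ → ℂ} (hf : Function.Periodic f (k : ℤ))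
    {d : ℤ} (hd : IsCoprime d k) : ∑ x : ZMod k, f (x.val * d) = ∑ x : ZMod k, f x.val := by
  refine sum_periodic_comp hf (fun x => x.val * d) ?_
  have hu : IsUnit (d : ZMod k) := (ZMod.coe_int_isUnit_iff_isCoprime d k).2 hd.symm
  simpa using hu.unit.mulRight_bijective

theorem stdAddChar_eq_exp (r : ℕ) (n : ℤ) :
    ZMod.stdAddChar (N := r + 1) (n : ZMod (r + 1)) = cexp (2 * Real.pi * I * n / (r + 1)) := by
  rw [ZMod.stdAddChar_coe]; push_cast; rfl

theorem indexTheta_add_div (r : ℕ) (t j : ℤ) (τ u : ℂ) :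
    indexTheta r t τ (u + j / (r + 1)) =
      ZMod.stdAddChar ((t * j : ℤ) : ZMod (r + 1)) * indexTheta r t τ u := by
  have hr := natCast_add_one_ne_zero r
  have e1 : ((r + 1) * (u + j / (r + 1)) + t * τ : ℂ) = (r + 1) * u + t * τ + j * 1 := by
    field_simp; ring
  have hper : Function.Periodic (fun z => jacobiTheta₂ z ((r + 1) * τ)) 1 :=
    fun z => jacobiTheta₂_add_left z _
  rw [indexTheta, indexTheta, e1, stdAddChar_eq_exp, ← mul_assoc, ← exp_add]
  have : jacobiTheta₂ ((r + 1) * u + t * τ + j * 1) ((r + 1) * τ) = _ :=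
    hper.int_mul j ((r + 1) * u + t * τ)
  rw [this]
  congr 2
  push_cast
  field_simp
  ring

/-- A single component of the theta decomposition, extracted by averaging over translations. -/
theorem sum_jacobiTheta₂_pow (r : ℕ) {τ : ℂ} (hτ : 0 < τ.im) (u : ℂ) (s : ZMod (r + 1)) :
    ∑ j : ZMod (r + 1), ZMod.stdAddChar (-(s * j)) *
        jacobiTheta₂ (u + (j.val : ℤ) / (r + 1)) τ ^ (r + 1) =
      (r + 1) * (cosetTheta r s.val τ * indexTheta r s.val τ u) := by
  have h1 (j : ZMod (r + 1)) : ZMod.stdAddChar (-(s * j)) *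
        jacobiTheta₂ (u + (j.val : ℤ) / (r + 1)) τ ^ (r + 1) =
      ∑ t : ZMod (r + 1), (cosetTheta r t.val τ * indexTheta r t.val τ u) *
        ZMod.stdAddChar (j * (t - s)) := by
    rw [jacobiTheta₂_pow_eq r hτ, Finset.mul_sum]
    refine Finset.sum_congr rfl fun t _ => ?_
    rw [indexTheta_add_div, show j * (t - s) = -(s * j) + t * j by ring, AddChar.map_add_eq_mul]
    push_cast
    rw [ZMod.natCast_zmod_val, ZMod.natCast_zmod_val]
    ring
  simp_rw [h1]
  rw [Finset.sum_comm]
  simp_rw [← Finset.mul_sum, AddChar.sum_mulShift _ (ZMod.isPrimitive_stdAddChar (r + 1)),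
    sub_eq_zero]
  simp
  ring

/-! ### Nonvanishing of the Jacobi theta function -/

theorem add_one_mul_im_pos (r : ℕ) {τ : ℂ} (hτ : 0 < τ.im) : 0 < ((r + 1) * τ).im := by
  have : ((r + 1) * τ).im = (r + 1) * τ.im := by simp
  rw [this]; positivity

theorem div_add_one_im_pos (r : ℕ) {τ : ℂ} (hτ : 0 < τ.im) : 0 < (τ / (r + 1)).im := by
  have : (τ / (r + 1)).im = τ.im / (r + 1) := by
    rw [show (r + 1 : ℂ) = ((r + 1 : ℝ) : ℂ) by push_cast; rfl, div_ofReal_im]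
  rw [this]; positivity

/-- Split the summation index of `θ(u, τ/(r + 1))` into residue classes modulo `r + 1`. -/
theorem jacobiTheta₂_div_eq (r : ℕ) {τ : ℂ} (hτ : 0 < τ.im) (u : ℂ) :
    jacobiTheta₂ u (τ / (r + 1)) = ∑ t : ZMod (r + 1), indexTheta r t.val τ u := by
  have hr := natCast_add_one_ne_zero r
  have h1 := hasSum_jacobiTheta₂_term u (div_add_one_im_pos r hτ)
  rw [← ((Equiv.prodComm _ _).trans (Int.divModEquiv (r + 1)).symm).hasSum_iff] at h1
  have h2 := h1.prod_fiberwise (g := fun t : Fin (r + 1) => indexTheta r (t : ℕ) τ u) fun t => by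
    refine hasSum_of_eq (hasSum_indexTheta r hτ u (t : ℕ)) fun l => ?_
    simp only [Function.comp_apply, Equiv.trans_apply, Equiv.prodComm_apply, Prod.swap,
      Int.divModEquiv_symm_apply, jacobiTheta₂_term]
    congr 1
    push_cast
    field_simp
    ring
  exact h2.unique (hasSum_fintype _)

theorem sum_jacobiTheta₂_div (r : ℕ) {τ : ℂ} (hτ : 0 < τ.im) (u : ℂ) :
    ∑ j : ZMod (r + 1), jacobiTheta₂ (u + (j.val : ℤ) / (r + 1)) (τ / (r + 1)) =
      (r + 1) * indexTheta r 0 τ u := by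
  have h1 (j : ZMod (r + 1)) : jacobiTheta₂ (u + (j.val : ℤ) / (r + 1)) (τ / (r + 1)) =
      ∑ t : ZMod (r + 1), indexTheta r t.val τ u * ZMod.stdAddChar (j * t) := by
    rw [jacobiTheta₂_div_eq r hτ]
    refine Finset.sum_congr rfl fun t _ => ?_
    rw [indexTheta_add_div]
    push_cast
    rw [ZMod.natCast_zmod_val, ZMod.natCast_zmod_val, mul_comm j t, mul_comm]
  simp_rw [h1]
  rw [Finset.sum_comm]
  simp_rw [← Finset.mul_sum, AddChar.sum_mulShift _ (ZMod.isPrimitive_stdAddChar (r + 1))]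
  simp
  ring

theorem indexTheta_zero (r : ℕ) (τ u : ℂ) :
    indexTheta r 0 τ u = jacobiTheta₂ ((r + 1) * u) ((r + 1) * τ) := by
  simp [indexTheta]

/-- If `θ(·, τ)` vanished identically, averaging over translates would force `θ(0, (r + 1)²τ) = 0`
for every `r`, but these values tend to 1. -/
theorem exists_jacobiTheta₂_ne_zero {τ : ℂ} (hτ : 0 < τ.im) : ∃ u, jacobiTheta₂ u τ ≠ 0 := by
  by_contra! h
  have h0 (r : ℕ) : jacobiTheta ((r + 1) ^ 2 * τ) = 0 := by
    have hr := natCast_add_one_ne_zero r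
    have h1 := sum_jacobiTheta₂_div r (add_one_mul_im_pos r hτ) 0
    rw [mul_div_cancel_left₀ _ hr, indexTheta_zero, ← mul_assoc, ← sq, mul_zero,
      ← jacobiTheta_eq_jacobiTheta₂] at h1
    simp only [h, Finset.sum_const_zero] at h1
    exact (mul_eq_zero.1 h1.symm).resolve_left hr
  obtain ⟨r, hr⟩ := exists_nat_gt (1 / τ.im)
  have h2 := h0 r
  have him : 1 ≤ ((r + 1) ^ 2 * τ : ℂ).im := by
    have e : ((r + 1) ^ 2 * τ : ℂ).im = (r + 1) ^ 2 * τ.im := by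
      rw [show ((r + 1) ^ 2 * τ : ℂ) = (((r + 1) ^ 2 : ℝ) : ℂ) * τ by push_cast; rfl, im_ofReal_mul]
    rw [e]
    rw [div_lt_iff₀ hτ] at hr
    have : (r : ℝ) ≤ (r + 1) ^ 2 := by nlinarith [(Nat.cast_nonneg r : (0 : ℝ) ≤ r)]
    nlinarith
  have h3 := norm_jacobiTheta_sub_one_le (lt_of_lt_of_le one_pos him)
  rw [h2] at h3
  set y := ((r + 1) ^ 2 * τ : ℂ).im
  have h4 : Real.exp (-Real.pi * y) < 1 / 4 := by
    have hy : -Real.pi * y ≤ -3 := by nlinarith [Real.pi_gt_three]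
    have h6 : Real.exp (-Real.pi * y) ≤ (Real.exp 3)⁻¹ := by
      rw [← Real.exp_neg]; exact Real.exp_le_exp.2 hy
    have h8 : (4 : ℝ) < Real.exp 3 := by
      have := Real.add_one_lt_exp (x := (3 : ℝ)) (by norm_num)
      linarith
    calc _ ≤ (Real.exp 3)⁻¹ := h6
      _ < 4⁻¹ := by gcongr
      _ = 1 / 4 := by norm_num
  set e := Real.exp (-Real.pi * y)
  have h5 : 0 < e := Real.exp_pos _
  simp only [zero_sub, norm_neg, norm_one] at h3
  rw [div_mul_eq_mul_div, le_div_iff₀ (by linarith)] at h3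
  linarith

/-! ### Transformation of the theta series of the root lattice -/

theorem jacobiTheta₂_add_int_mul (u τ : ℂ) (n : ℤ) :
    jacobiTheta₂ (u + n * τ) τ =
      cexp (-(Real.pi * I * τ * n ^ 2 + 2 * Real.pi * I * n * u)) * jacobiTheta₂ u τ := by
  have h := (indexTheta_periodic 0 τ u).int_mul n 0
  simp only [indexTheta] at h
  simp only [zero_add, Nat.cast_one, mul_one, Int.cast_id] at h
  norm_num at h
  rw [← h, ← mul_assoc, ← exp_add]
  simp

/-- Behaviour of powers of translates of the Jacobi theta function under a matrix in `Γ(2)` whose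
lower left entry is divisible by `2 (r + 1)`. -/
theorem jacobiTheta₂_translate_pow {r : ℕ} {a b c d : ℤ} (hdet : a * d - b * ((r + 1 : ℕ) * c) = 1)
    (hb : Even b) (hc : Even c) {τ : ℂ} (hτ : 0 < τ.im) (u : ℂ) (j : ℤ) :
    jacobiTheta₂ (u / (((r + 1 : ℕ) * c : ℤ) * τ + d) + j / (r + 1))
        ((a * τ + b) / (((r + 1 : ℕ) * c : ℤ) * τ + d)) ^ (r + 1) =
      (thetaMult ((r + 1 : ℕ) * c) d * (((r + 1 : ℕ) * c : ℤ) * τ + d) ^ (1 / 2 : ℂ)) ^ (r + 1) *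
        cexp (Real.pi * I * c * ((r + 1) * u) ^ 2 / (((r + 1 : ℕ) * c : ℤ) * τ + d)) *
        jacobiTheta₂ (u + (j * d : ℤ) / (r + 1)) τ ^ (r + 1) := by
  have hr := natCast_add_one_ne_zero r
  have hJ := int_mul_add_ne_zero (isCoprime_of_det hdet) hτ
  have h1 := jacobiLaw_of_even hdet hb (hc.mul_left _) τ hτ
    (u + j / (r + 1) * (((r + 1 : ℕ) * c : ℤ) * τ + d))
  -- Since `r + 1` divides the lower left entry, the translation becomes `jd/(r + 1)` plus the
  -- period `jcτ`.
  have e1 : u + j / (r + 1) * (((r + 1 : ℕ) * c : ℤ) * τ + d) =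
      (u + (j * d : ℤ) / (r + 1)) + (j * c : ℤ) * τ := by
    push_cast; field_simp; ring
  rw [add_div, mul_div_cancel_right₀ _ hJ, e1, jacobiTheta₂_add_int_mul] at h1
  rw [h1, mul_pow, mul_pow, mul_pow _ (jacobiTheta₂ _ _), ← exp_nat_mul, ← exp_nat_mul]
  have e2 : cexp (Real.pi * I * c * ((r + 1) * u) ^ 2 / (((r + 1 : ℕ) * c : ℤ) * τ + d)) =
      cexp (((r + 1 : ℕ) : ℂ) * (Real.pi * I * ((r + 1 : ℕ) * c : ℤ) *
        ((u + (j * d : ℤ) / (r + 1)) + (j * c : ℤ) * τ) ^ 2 / (((r + 1 : ℕ) * c : ℤ) * τ + d))) *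
      cexp (((r + 1 : ℕ) : ℂ) * -(Real.pi * I * τ * (j * c : ℤ) ^ 2 +
        2 * Real.pi * I * (j * c : ℤ) * (u + (j * d : ℤ) / (r + 1)))) := by
    obtain ⟨e, rfl⟩ := hc
    rw [← exp_add, exp_eq_exp_iff_exists_int]
    -- The exponents differ by `πi j²cd`; this is a multiple of `2πi` because `c = 2e`.
    refine ⟨j ^ 2 * e * d, ?_⟩
    set J : ℂ := ((r + 1 : ℕ) * (e + e) : ℤ) * τ + d with hJdef
    have hd : (d : ℂ) = J - (r + 1) * (2 * e) * τ := by rw [hJdef]; push_cast; ring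
    push_cast
    rw [hd]
    field_simp
    ring
  rw [e2]
  ring

/-- Evaluate the average of the powers of translates at the image point in two ways. Its component
zero carries the factor `θ((r + 1)u, (r + 1)τ)`, whose own multiplier is the one on the left-hand
side. -/
theorem cosetTheta_zero_transform {r : ℕ} {a b c d : ℤ}
    (hdet : a * d - b * ((r + 1 : ℕ) * c) = 1) (hb : Even b) (hc : Even c) {τ : ℂ}
    (hτ : 0 < τ.im) :
    cosetTheta r 0 ((a * τ + b) / (((r + 1 : ℕ) * c : ℤ) * τ + d)) *
        (thetaMult c d * (((r + 1 : ℕ) * c : ℤ) * τ + d) ^ (1 / 2 : ℂ)) =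
      (thetaMult ((r + 1 : ℕ) * c) d * (((r + 1 : ℕ) * c : ℤ) * τ + d) ^ (1 / 2 : ℂ)) ^ (r + 1) *
        cosetTheta r 0 τ := by
  have hr := natCast_add_one_ne_zero r
  have hJ := int_mul_add_ne_zero (isCoprime_of_det hdet) hτ
  have him := moebius_im_pos hdet hτ
  obtain ⟨v, hv⟩ := exists_jacobiTheta₂_ne_zero (add_one_mul_im_pos r hτ)
  set J : ℂ := ((r + 1 : ℕ) * c : ℤ) * τ + d with hJdef
  set u := v / (r + 1) with hu
  have hv' : (r + 1) * u = v := mul_div_cancel₀ _ hr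
  have h1 := sum_jacobiTheta₂_pow r him (u / J) 0
  have h2 := sum_jacobiTheta₂_pow r hτ u 0
  simp only [zero_mul, neg_zero, AddChar.map_zero_eq_one, one_mul, ZMod.val_zero, Nat.cast_zero,
    indexTheta_zero] at h1 h2
  have hper : Function.Periodic (fun n : ℤ => jacobiTheta₂ (u + (n : ℂ) / (r + 1)) τ ^ (r + 1))
      ((r + 1 : ℕ) : ℤ) := by
    intro n
    have : u + ((n + (r + 1 : ℕ) : ℤ) : ℂ) / (r + 1) = u + (n : ℂ) / (r + 1) + 1 := by
      push_cast; field_simp; ring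
    simp only [this, jacobiTheta₂_add_left]
  have hcop : IsCoprime d ((r + 1 : ℕ) : ℤ) := ⟨a, -(b * c), by linarith⟩
  have h3 := sum_periodic_mul hper hcop
  have h4 : ∑ j : ZMod (r + 1), jacobiTheta₂ (u / J + (j.val : ℤ) / (r + 1))
        ((a * τ + b) / J) ^ (r + 1) = (thetaMult ((r + 1 : ℕ) * c) d * J ^ (1 / 2 : ℂ)) ^ (r + 1) *
        cexp (Real.pi * I * c * ((r + 1) * u) ^ 2 / J) *
        ∑ j : ZMod (r + 1), jacobiTheta₂ (u + (j.val : ℤ) / (r + 1)) τ ^ (r + 1) := by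
    rw [← h3, Finset.mul_sum]
    exact Finset.sum_congr rfl fun j _ => jacobiTheta₂_translate_pow hdet hb hc hτ u j.val
  have h5 := jacobiLaw_of_even (a := a) (b := (r + 1 : ℕ) * b) (c := c) (d := d)
    (by linarith) (hb.mul_left _) hc _ (add_one_mul_im_pos r hτ) ((r + 1) * u)
  have e1 : (c : ℂ) * ((r + 1) * τ) + d = J := by rw [hJdef]; push_cast; ring
  have e2 : (a : ℂ) * ((r + 1) * τ) + ((r + 1 : ℕ) * b : ℤ) = (r + 1) * (a * τ + b) := by
    push_cast; ring
  rw [e1, e2, mul_div_assoc, mul_div_assoc] at h5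
  rw [h1, h2, h5, hv'] at h4
  have hE := exp_ne_zero (Real.pi * I * c * v ^ 2 / J)
  have hne : (r + 1 : ℂ) * cexp (Real.pi * I * c * v ^ 2 / J) * jacobiTheta₂ v ((r + 1) * τ) ≠ 0 :=
    mul_ne_zero (mul_ne_zero hr hE) hv
  apply mul_right_cancel₀ hne
  linear_combination h4

/-- From `x² ≡ x` modulo 2; for `s = 0` it makes `A_r` an even lattice, whence invariance under `τ ↦
τ + 1`. -/
theorem even_sqSum_sub {r : ℕ} (s : ℤ) (m : Fin r → ℤ) : Even (sqSum s m - s) := by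
  have h (x : ℤ) : Even (x ^ 2 - x) := by
    rw [show x ^ 2 - x = (x - 1) * ((x - 1) + 1) by ring]; exact Int.even_mul_succ_self _
  have h1 : sqSum s m - s = ∑ i, (m i ^ 2 - m i) + ((s - ∑ i, m i) ^ 2 - (s - ∑ i, m i)) := by
    rw [sqSum, Finset.sum_sub_distrib]; ring
  rw [h1]
  exact (Finset.even_sum _ fun i _ => h _).add (h _)

theorem cosetTheta_add_one (r : ℕ) (s : ℤ) (τ : ℂ) :
    cosetTheta r s (τ + 1) = cexp (Real.pi * I * (s - s ^ 2 / (r + 1))) * cosetTheta r s τ := by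
  rw [cosetTheta, cosetTheta, ← tsum_mul_left]
  refine tsum_congr fun m => ?_
  obtain ⟨e, he⟩ := even_sqSum_sub s m
  have he' : (sqSum s m : ℂ) = s + (e + e) := by
    rw [show sqSum s m = s + (e + e) by lia]; push_cast; ring
  rw [← exp_add, exp_eq_exp_iff_exists_int]
  refine ⟨e, ?_⟩
  rw [he']
  ring

theorem cosetTheta_zero_add_int (r : ℕ) (τ : ℂ) (n : ℤ) :
    cosetTheta r 0 (τ + n) = cosetTheta r 0 τ := by
  have : Function.Periodic (cosetTheta r 0) 1 := fun τ => by
    rw [cosetTheta_add_one]; simp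
  simpa using this.int_mul n τ

/-! ### The inversion formula -/

theorem neg_one_div_im_pos {τ : ℂ} (hτ : 0 < τ.im) : 0 < (-1 / τ).im := by
  have := moebius_im_pos (a := 0) (b := -1) (c := 1) (d := 0) (by norm_num) hτ
  simpa using this

theorem indexTheta_neg_one_div (r : ℕ) (s : ℤ) {τ : ℂ} (hτ : 0 < τ.im) (u : ℂ) :
    indexTheta r s (-1 / τ) (u / τ) = (-I * (τ / (r + 1))) ^ (1 / 2 : ℂ) *
      cexp (Real.pi * I * (r + 1) * u ^ 2 / τ) *
        jacobiTheta₂ (u - s / (r + 1)) (τ / (r + 1)) := by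
  have hr := natCast_add_one_ne_zero r
  have hτ0 : τ ≠ 0 := by rintro rfl; simp at hτ
  have h := jacobiTheta₂_S (div_add_one_im_pos r hτ) (u - s / (r + 1))
  have e1 : (r + 1) * (u / τ) + s * (-1 / τ) = (u - s / (r + 1)) / (τ / (r + 1)) := by
    field_simp; ring
  have e2 : (r + 1) * (-1 / τ) = -1 / (τ / (r + 1)) := by field_simp
  have e3 : cexp (Real.pi * I * (r + 1) * u ^ 2 / τ) =
      cexp (Real.pi * I * (-1 / τ) * s ^ 2 / (r + 1) + 2 * Real.pi * I * s * (u / τ)) *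
        cexp (Real.pi * I * (u - s / (r + 1)) ^ 2 / (τ / (r + 1))) := by
    rw [← exp_add]; congr 1; field_simp; ring
  rw [indexTheta, e1, e2, h, e3]
  ring

theorem indexTheta_add_mul_div (r : ℕ) (t j : ℤ) (τ u : ℂ) :
    indexTheta r t τ (u + j * τ / (r + 1)) =
      cexp (-(Real.pi * I * τ * j ^ 2 / (r + 1) + 2 * Real.pi * I * j * u)) *
        indexTheta r (t + j) τ u := by
  have hr := natCast_add_one_ne_zero r
  have e1 : (r + 1) * (u + j * τ / (r + 1)) + t * τ = (r + 1) * u + (t + j : ℤ) * τ := by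
    push_cast; field_simp; ring
  rw [indexTheta, indexTheta, e1, ← mul_assoc, ← exp_add]
  congr 2
  push_cast
  field_simp
  ring

theorem jacobiTheta₂_neg_one_div_pow (r : ℕ) (j : ℤ) {τ : ℂ} (hτ : 0 < τ.im) (u : ℂ) :
    jacobiTheta₂ (u / τ + j / (r + 1)) (-1 / τ) ^ (r + 1) =
      ((-I * τ) ^ (1 / 2 : ℂ)) ^ (r + 1) * cexp (Real.pi * I * (r + 1) * u ^ 2 / τ) *
        ∑ t : ZMod (r + 1), cosetTheta r t.val τ * indexTheta r (t.val + j) τ u := by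
  have hr := natCast_add_one_ne_zero r
  have hτ0 : τ ≠ 0 := by rintro rfl; simp at hτ
  have e1 : u / τ + j / (r + 1) = (u + j * τ / (r + 1)) / τ := by field_simp
  have e2 : cexp (Real.pi * I * (r + 1) * u ^ 2 / τ) =
      cexp (((r + 1 : ℕ) : ℂ) * (Real.pi * I * (u + j * τ / (r + 1)) ^ 2 / τ)) *
        cexp (-(Real.pi * I * τ * j ^ 2 / (r + 1) + 2 * Real.pi * I * j * u)) := by
    rw [← exp_add]; congr 1; push_cast; field_simp; ring
  have e3 : ∑ t : ZMod (r + 1), cosetTheta r t.val τ *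
      indexTheta r t.val τ (u + j * τ / (r + 1)) =
      cexp (-(Real.pi * I * τ * j ^ 2 / (r + 1) + 2 * Real.pi * I * j * u)) *
        ∑ t : ZMod (r + 1), cosetTheta r t.val τ * indexTheta r (t.val + j) τ u := by
    rw [Finset.mul_sum]
    refine Finset.sum_congr rfl fun t _ => ?_
    rw [indexTheta_add_mul_div]
    ring
  rw [e1, jacobiTheta₂_S hτ, mul_pow, mul_pow, jacobiTheta₂_pow_eq r hτ, ← exp_nat_mul, e2, e3]
  ring

/-- The constant in the inversion formula. -/
def inversionConst (r : ℕ) : ℂ := (((r + 1 : ℂ)⁻¹) ^ (1 / 2 : ℂ) * (r + 1))⁻¹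

/-- Extract component `s` of `θ^(r + 1)` at `-1/τ`. After inversion both sides contain the same
factor `θ(v, τ/(r + 1))`, which cancels. -/
theorem cosetTheta_neg_one_div (r : ℕ) (s : ZMod (r + 1)) {τ : ℂ} (hτ : 0 < τ.im) :
    cosetTheta r s.val (-1 / τ) = inversionConst r * ((-I * τ) ^ (1 / 2 : ℂ)) ^ r *
      ∑ t : ZMod (r + 1), ZMod.stdAddChar (s * t) * cosetTheta r t.val τ := by
  have hr := natCast_add_one_ne_zero r
  have hτ0 : τ ≠ 0 := by rintro rfl; simp at hτ
  obtain ⟨v, hv⟩ := exists_jacobiTheta₂_ne_zero (div_add_one_im_pos r hτ)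
  -- The shift puts the common factor at `v`, chosen so that it does not vanish.
  set u : ℂ := v + (s.val : ℤ) / (r + 1) with hu
  have hv' : u - (s.val : ℤ) / (r + 1) = v := by rw [hu]; ring
  have h1 := sum_jacobiTheta₂_pow r (neg_one_div_im_pos hτ) (u / τ) s
  rw [indexTheta_neg_one_div r _ hτ, hv'] at h1
  have h2 : jacobiTheta₂ v (τ / (r + 1)) =
      ∑ t : ZMod (r + 1), ZMod.stdAddChar (-(s * t)) * indexTheta r t.val τ u := by
    rw [jacobiTheta₂_div_eq r hτ]
    refine Finset.sum_congr rfl fun t _ => ?_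
    have : v = u + ((-(s.val : ℤ) : ℤ) : ℂ) / (r + 1) := by rw [← hv']; push_cast; ring
    rw [this, indexTheta_add_div]
    congr 2
    push_cast
    rw [ZMod.natCast_zmod_val, ZMod.natCast_zmod_val]
    ring
  have hper : Function.Periodic (fun n : ℤ => ZMod.stdAddChar (-(s * (n : ZMod (r + 1)))) *
      indexTheta r n τ u) ((r + 1 : ℕ) : ℤ) := by
    intro n
    have h := indexTheta_periodic r τ u n
    simp only at h ⊢
    rw [h, Int.cast_add, Int.cast_natCast, ZMod.natCast_self, add_zero]
  have h3 (t : ZMod (r + 1)) : ∑ j : ZMod (r + 1), ZMod.stdAddChar (-(s * j)) *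
      indexTheta r (t.val + j.val) τ u =
      ZMod.stdAddChar (s * t) * jacobiTheta₂ v (τ / (r + 1)) := by
    have h4 := sum_periodic_add hper t.val
    simp only [Int.cast_natCast, ZMod.natCast_zmod_val] at h4
    rw [h2, ← h4, Finset.mul_sum]
    refine Finset.sum_congr rfl fun j _ => ?_
    push_cast
    rw [ZMod.natCast_zmod_val, ZMod.natCast_zmod_val, ← mul_assoc, ← AddChar.map_add_eq_mul,
      add_comm (t.val : ℤ)]
    congr 2
    ring
  have h5 : ∑ j : ZMod (r + 1), ZMod.stdAddChar (-(s * j)) *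
        jacobiTheta₂ (u / τ + (j.val : ℤ) / (r + 1)) (-1 / τ) ^ (r + 1) =
      ((-I * τ) ^ (1 / 2 : ℂ)) ^ (r + 1) * cexp (Real.pi * I * (r + 1) * u ^ 2 / τ) *
        ((∑ t : ZMod (r + 1), ZMod.stdAddChar (s * t) * cosetTheta r t.val τ) *
          jacobiTheta₂ v (τ / (r + 1))) := by
    simp_rw [jacobiTheta₂_neg_one_div_pow r _ hτ, Finset.mul_sum]
    rw [Finset.sum_comm, Finset.sum_mul, Finset.mul_sum]
    refine Finset.sum_congr rfl fun t _ => ?_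
    calc _ = ((-I * τ) ^ (1 / 2 : ℂ)) ^ (r + 1) * cexp (Real.pi * I * (r + 1) * u ^ 2 / τ) *
          cosetTheta r t.val τ * (ZMod.stdAddChar (s * t) * jacobiTheta₂ v (τ / (r + 1))) := by
          rw [← h3, Finset.mul_sum]
          refine Finset.sum_congr rfl fun j _ => ?_
          ring
      _ = _ := by ring
  rw [h5] at h1
  have e1 : (-I * (τ / (r + 1))) ^ (1 / 2 : ℂ) =
      ((r + 1 : ℂ)⁻¹) ^ (1 / 2 : ℂ) * (-I * τ) ^ (1 / 2 : ℂ) := by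
    rw [← mul_cpow_half (inv_ne_zero hr) (mul_ne_zero (by simp) hτ0)]
    · congr 1; field_simp
    · have : (r + 1 : ℂ)⁻¹.arg = 0 := by
        rw [show (r + 1 : ℂ)⁻¹ = (((r + 1 : ℝ)⁻¹ : ℝ) : ℂ) by push_cast; rfl]
        exact arg_ofReal_of_nonneg (by positivity)
      rw [this, zero_add]
      exact arg_mem_Ioc _
  rw [e1] at h1
  have n1 := cpow_half_ne_zero (inv_ne_zero hr)
  have n2 : (-I * τ) ^ (1 / 2 : ℂ) ≠ 0 := cpow_half_ne_zero (mul_ne_zero (by simp) hτ0)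
  have n3 := exp_ne_zero (Real.pi * I * (r + 1) * u ^ 2 / τ)
  rw [inversionConst]
  generalize ((r + 1 : ℂ)⁻¹) ^ (1 / 2 : ℂ) = A at *
  generalize (-I * τ) ^ (1 / 2 : ℂ) = B at *
  generalize cexp (Real.pi * I * (r + 1) * u ^ 2 / τ) = E at *
  have hinv := mul_inv_cancel₀ (mul_ne_zero n1 hr)
  apply mul_left_cancel₀ (mul_ne_zero (mul_ne_zero (mul_ne_zero (mul_ne_zero n1 hr) n2) n3) hv)
  linear_combination (-1) * h1 - B ^ (r + 1) * E *
    (∑ t : ZMod (r + 1), ZMod.stdAddChar (s * t) * cosetTheta r t.val τ) *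
    jacobiTheta₂ v (τ / (r + 1)) * hinv

theorem cosetTheta_add_int (r : ℕ) (s : ℤ) (τ : ℂ) (n : ℤ) :
    cosetTheta r s (τ + n) = cexp (Real.pi * I * (s - s ^ 2 / (r + 1)) * n) * cosetTheta r s τ := by
  have hper : Function.Periodic (fun τ => cexp (-(Real.pi * I * (s - s ^ 2 / (r + 1)) * τ)) *
      cosetTheta r s τ) 1 := fun τ => by
    simp only
    rw [cosetTheta_add_one, ← mul_assoc, ← exp_add]
    congr 2
    ring
  have h : cexp (-(Real.pi * I * (s - s ^ 2 / (r + 1)) * (τ + n * 1))) *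
      cosetTheta r s (τ + n * 1) = _ := hper.int_mul n τ
  rw [mul_one] at h
  apply mul_left_cancel₀ (exp_ne_zero (-(Real.pi * I * (s - s ^ 2 / (r + 1)) * (τ + n))))
  rw [h, ← mul_assoc, ← exp_add]
  congr 2
  ring

/-- For even `r` the integer `s(r + 1) - s²` is even, so the phase is trivial. -/
theorem cosetTheta_add_level {r : ℕ} (hr : Even r) (s : ℤ) (τ : ℂ) (m : ℤ) :
    cosetTheta r s (τ + ((r + 1 : ℕ) * m : ℤ)) = cosetTheta r s τ := by
  have hr0 := natCast_add_one_ne_zero r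
  rw [cosetTheta_add_int]
  have h1 : Even (s * (r + 1) - s ^ 2) := by
    rw [show s * (r + 1) - s ^ 2 = s * r - (s - 1) * ((s - 1) + 1) by ring]
    exact (Even.mul_left (by exact_mod_cast hr) _).sub (Int.even_mul_succ_self _)
  obtain ⟨e, he⟩ := h1
  have he' : (s * (r + 1) - s ^ 2 : ℂ) = e + e := by exact_mod_cast he
  have : cexp (Real.pi * I * (s - s ^ 2 / (r + 1)) * ((r + 1 : ℕ) * m : ℤ)) = 1 := by
    rw [exp_eq_one_iff]
    refine ⟨e * m, ?_⟩
    push_cast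
    field_simp
    linear_combination (m : ℂ) * he'
  rw [this, one_mul]

/-- The transformation law under lower unipotent matrices of level `r + 1`, for even `r`. -/
theorem cosetTheta_lower_unipotent {q : ℕ} (m : ℤ) {τ : ℂ} (hτ : 0 < τ.im) :
    cosetTheta (2 * q) 0 (τ / (((2 * q + 1 : ℕ) * m : ℤ) * τ + 1)) =
      (((2 * q + 1 : ℕ) * m : ℤ) * τ + 1) ^ q * cosetTheta (2 * q) 0 τ := by
  have hτ0 : τ ≠ 0 := by rintro rfl; simp at hτ
  have hJ : (((2 * q + 1 : ℕ) * m : ℤ) * τ + 1 : ℂ) ≠ 0 := by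
    have := int_mul_add_ne_zero (c := (2 * q + 1 : ℕ) * m) (d := 1) isCoprime_one_right hτ
    rwa [Int.cast_one] at this
  have h1 := neg_one_div_im_pos hτ
  set n : ℤ := (2 * q + 1 : ℕ) * m with hn
  have hσim : 0 < (-1 / τ + (-n : ℤ)).im := by simpa using h1
  have hσ0 : -1 / τ + (-n : ℤ) ≠ 0 := by intro h; rw [h] at hσim; simp at hσim
  -- Invert, translate by a multiple of the level, invert again; the rank `2q` is even, so no square
  -- roots survive.
  have e1 : τ / (n * τ + 1) = -1 / (-1 / τ + (-n : ℤ)) := by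
    rw [div_eq_div_iff hJ hσ0]; push_cast; field_simp; ring
  have e2 : τ = -1 / (-1 / τ) := by field_simp
  have h2 := cosetTheta_neg_one_div (2 * q) 0 hσim
  have h3 := cosetTheta_neg_one_div (2 * q) 0 h1
  rw [← e1] at h2
  rw [← e2] at h3
  have e3 (t : ℤ) : cosetTheta (2 * q) t (-1 / τ + (-n : ℤ)) = cosetTheta (2 * q) t (-1 / τ) := by
    rw [← cosetTheta_add_level (even_two_mul q) t (-1 / τ) (-m), hn, mul_neg]
  simp only [e3] at h2
  simp only [ZMod.val_zero, Nat.cast_zero] at h2 h3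
  rw [h2, h3, pow_mul, pow_mul, cpow_half_sq, cpow_half_sq]
  have e4 : -I * (-1 / τ + (-n : ℤ)) = (n * τ + 1) * (-I * (-1 / τ)) := by
    push_cast; field_simp; ring
  rw [e4, mul_pow]
  ring

/-! ### The theta series of the statement -/

/-- Identifies `Q` with half the norm form of `A_r`. -/
theorem two_mul_Q {r : ℕ} (m : Fin r → ℤ) : 2 * Q m = sqSum 0 m := by
  have h1 := Finset.sum_sum_Ioi_add_eq_sum_sum_off_diag (fun i j => m i * m j)
  have h2 : (∑ i, m i) ^ 2 = ∑ i, m i ^ 2 + ∑ i, ∑ j ∈ {i}ᶜ, m j * m i := by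
    rw [sq, Finset.sum_mul_sum, ← Finset.sum_add_distrib]
    refine Finset.sum_congr rfl fun i _ => ?_
    rw [← Finset.sum_add_sum_compl {i}, Finset.sum_singleton, sq]
    congr 1
    exact Finset.sum_congr rfl fun j _ => mul_comm _ _
  have h3 (i j : Fin r) : m j * m i + m i * m j = 2 * (m i * m j) := by ring
  simp only [h3, ← Finset.mul_sum] at h1
  rw [Q, sqSum, zero_sub, neg_sq, h2, ← h1]
  simp only [← Finset.mul_sum]
  ring

theorem thetaTerm_eq {r : ℕ} (z : ℍ) (m : Fin r → ℤ) :
    thetaTerm z m = cexp (Real.pi * I * z * (sqSum 0 m - (0 : ℤ) ^ 2 / (r + 1))) := by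
  rw [thetaTerm, ← exp_int_mul, ← two_mul_Q]
  congr 1
  push_cast
  ring

theorem summable_thetaTerm {r : ℕ} (z : ℍ) : Summable fun m : Fin r → ℤ => thetaTerm z m := by
  simp_rw [thetaTerm_eq]
  exact summable_cosetTheta r 0 z.im_pos

theorem theta_succ (r : ℕ) (z : ℍ) : theta (r + 1) z = cosetTheta r 0 z :=
  tsum_congr fun m => thetaTerm_eq z m

/-! ### Explicit multipliers -/

theorem eps_sq {d : ℤ} (hd : Odd d) : eps d ^ 2 = (kroneckerSym (-1) d : ℂ) := by
  rw [kroneckerSym_neg_one hd]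
  rcases Int.odd_iff.1 hd |> fun h => (by lia : d % 4 = 1 ∨ d % 4 = 3) with h | h
  · rw [eps_of_emod_one h, ZMod.χ₄_int_one_mod_four h]; simp
  · rw [eps_of_emod_three h, ZMod.χ₄_int_three_mod_four h]; simp

theorem kroneckerSym_unit {a d : ℤ} (ha : 0 ≤ a) (hd : d = 1 ∨ d = -1) : kroneckerSym a d = 1 := by
  have hodd : Odd d := by rcases hd with rfl | rfl <;> decide
  rw [kroneckerSym_of_odd_of_nonneg_left hodd ha,
    show d.natAbs = 1 by rcases hd with rfl | rfl <;> rfl, jacobiSym.one_right]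

theorem kroneckerSym_sq' {a d : ℤ} (hd : Odd d) (h : IsCoprime a d) :
    (kroneckerSym a d : ℂ) ^ 2 = 1 := by
  exact_mod_cast kroneckerSym_sq hd h

theorem kroneckerSym_mul_cast {a b d : ℤ} (hd : Odd d) (ha : a ≠ 0) (hb : b ≠ 0) :
    (kroneckerSym (a * b) d : ℂ) = kroneckerSym a d * kroneckerSym b d := by
  exact_mod_cast kroneckerSym_mul_left hd ha hb

theorem kroneckerSym_neg_one_pow {d : ℤ} (hd : Odd d) (q : ℕ) :
    kroneckerSym ((-1) ^ q) d = kroneckerSym (-1) d ^ q := by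
  induction q with
  | zero => simp [kroneckerSym_of_odd hd]
  | succ n ih =>
    rw [pow_succ, kroneckerSym_mul_left hd (pow_ne_zero _ (by norm_num)) (by norm_num), ih, pow_succ]

theorem isCoprime_two_of_odd {d : ℤ} (hd : Odd d) : IsCoprime 2 d := by
  obtain ⟨m, rfl⟩ := hd
  exact ⟨-m, 1, by ring⟩

/-- Each of 2, `k`, `c` occurs twice. The case `c = 0` is separate, because multiplicativity in the
upper entry can fail at zero; there `d = ±1`. -/
theorem kroneckerSym_triple {k c d : ℤ} (hk : 0 < k) (hd : Odd d) (h : IsCoprime (k * c) d) :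
    (kroneckerSym (2 * k) d * kroneckerSym (k * c) d * kroneckerSym (2 * c) d : ℂ) = 1 := by
  have h2 := isCoprime_two_of_odd hd
  rcases eq_or_ne c 0 with rfl | hc
  · have hu : d = 1 ∨ d = -1 := by
      rw [mul_zero, isCoprime_zero_left] at h; exact Int.isUnit_iff.1 h
    rw [kroneckerSym_unit (by lia) hu, mul_zero, mul_zero, kroneckerSym_unit le_rfl hu]
    simp
  · rw [kroneckerSym_mul_cast hd two_ne_zero hk.ne', kroneckerSym_mul_cast hd hk.ne' hc,
      kroneckerSym_mul_cast hd two_ne_zero hc]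
    linear_combination (kroneckerSym k d : ℂ) ^ 2 * (kroneckerSym c d : ℂ) ^ 2 * kroneckerSym_sq' hd h2 +
      (kroneckerSym c d : ℂ) ^ 2 * kroneckerSym_sq' hd h.of_mul_left_left +
      kroneckerSym_sq' hd h.of_mul_left_right

theorem kroneckerSym_two_mul_mul {k c d : ℤ} (hk : 0 < k) (hd : Odd d) (h : IsCoprime (k * c) d) :
    (kroneckerSym (2 * (k * c)) d : ℂ) = kroneckerSym k d * kroneckerSym (2 * c) d := by
  rcases eq_or_ne c 0 with rfl | hc
  · have hu : d = 1 ∨ d = -1 := by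
      rw [mul_zero, isCoprime_zero_left] at h; exact Int.isUnit_iff.1 h
    rw [mul_zero, mul_zero, kroneckerSym_unit le_rfl hu, kroneckerSym_unit hk.le hu]
    simp
  · rw [← kroneckerSym_mul_cast hd hk.ne' (by lia)]
    congr 2; ring

theorem odd_of_det {a b c d : ℤ} (hdet : a * d - b * c = 1) (hc : Even c) : Odd a ∧ Odd d := by
  have : Odd (a * d) := by
    rw [show a * d = b * c + 1 by lia]; exact (hc.mul_left b).add_one
  exact Int.odd_mul.1 this

theorem thetaMult_ne_zero {c d : ℤ} (hd : Odd d) (h : IsCoprime (2 * c) d) : thetaMult c d ≠ 0 := by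
  refine mul_ne_zero ?_ (inv_ne_zero (eps_ne_zero d))
  intro h0
  have := kroneckerSym_sq' hd h
  rw [h0] at this
  simp at this

/-- Transformation law in odd rank. -/
theorem cosetTheta_transform_of_odd {r : ℕ} (hr : Odd r) {a b c d : ℤ}
    (hdet : a * d - b * c = 1) (hc : ((2 * (r + 1) : ℕ) : ℤ) ∣ c) {τ : ℂ} (hτ : 0 < τ.im) :
    cosetTheta r 0 ((a * τ + b) / (c * τ + d)) =
      kroneckerSym (2 * (r + 1 : ℕ)) d *
        ((kroneckerSym c d : ℂ) * (eps d)⁻¹ * (c * τ + d) ^ (1 / 2 : ℂ)) ^ r *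
          cosetTheta r 0 τ := by
  have hceven : Even c := by
    obtain ⟨e, rfl⟩ := hc; exact ⟨(r + 1) * e, by push_cast; ring⟩
  obtain ⟨ha, hd⟩ := odd_of_det hdet hceven
  -- Multiplying by `T` on the left replaces `b` by `b + d` with `d` odd, and `h_0` does not change.
  wlog hb : Even b generalizing a b
  · have hJ := int_mul_add_ne_zero (isCoprime_of_det hdet) hτ
    rw [Int.not_even_iff_odd] at hb
    have hdet' : (a + c) * d - (b + d) * c = 1 := by linarith
    have h := this hdet' (odd_of_det hdet' hceven).1 (hb.add_odd hd)
    rw [← h]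
    have e : (((a + c : ℤ) : ℂ) * τ + (b + d : ℤ)) / (c * τ + d) =
        (a * τ + b) / (c * τ + d) + (1 : ℤ) := by
      push_cast; field_simp; ring
    rw [e, cosetTheta_zero_add_int]
  obtain ⟨e, rfl⟩ := hc
  have hcc : ((2 * (r + 1) : ℕ) : ℤ) * e = (r + 1 : ℕ) * (2 * e) := by push_cast; ring
  rw [hcc] at hdet ⊢
  have h1 := cosetTheta_zero_transform hdet hb (even_two_mul e) hτ
  have hJ := int_mul_add_ne_zero (isCoprime_of_det hdet) hτ
  have hcop := isCoprime_of_det hdet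
  have h2 := isCoprime_two_of_odd hd
  have hk : (0 : ℤ) < (r + 1 : ℕ) := by positivity
  have hM := thetaMult_ne_zero hd (h2.mul_left hcop.of_mul_left_right)
  have hs := cpow_half_ne_zero hJ
  set J : ℂ := ((r + 1 : ℕ) * (2 * e) : ℤ) * τ + d
  apply mul_right_cancel₀ (mul_ne_zero hM hs)
  rw [h1]
  have ht := kroneckerSym_triple hk hd hcop
  have hx := kroneckerSym_sq' hd (h2.mul_left hcop)
  have hy := kroneckerSym_sq' hd hcop
  obtain ⟨q, rfl⟩ := hr
  rw [thetaMult, thetaMult]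
  generalize (kroneckerSym (2 * ((2 * q + 1 + 1 : ℕ) * (2 * e))) d : ℂ) = X at *
  generalize (kroneckerSym ((2 * q + 1 + 1 : ℕ) * (2 * e)) d : ℂ) = Y at *
  push_cast at ht ⊢
  -- The symbols are `±1`: the even power `r + 1` loses its symbol, the odd power `r` keeps one
  -- factor.
  have e1 : (X * (eps d)⁻¹ * J ^ (1 / 2 : ℂ)) ^ (2 * q + 1 + 1) =
      ((eps d)⁻¹ * J ^ (1 / 2 : ℂ)) ^ (2 * q + 1 + 1) := by
    rw [mul_assoc, mul_pow, show 2 * q + 1 + 1 = 2 * (q + 1) by ring, pow_mul X, hx, one_pow, one_mul]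
  have e2 : (Y * (eps d)⁻¹ * J ^ (1 / 2 : ℂ)) ^ (2 * q + 1) =
      Y * ((eps d)⁻¹ * J ^ (1 / 2 : ℂ)) ^ (2 * q + 1) := by
    rw [mul_assoc, mul_pow, pow_succ Y, pow_mul Y, hy, one_pow, one_mul]
  rw [e1, e2]
  linear_combination (-1) * ((eps d)⁻¹ * J ^ (1 / 2 : ℂ)) ^ (2 * q + 1 + 1) *
    cosetTheta (2 * q + 1) 0 τ * ht

/-- Transformation law in even rank. -/
theorem cosetTheta_transform_of_even {q : ℕ} {a b c d : ℤ}
    (hdet : a * d - b * c = 1) (hc : ((2 * q + 1 : ℕ) : ℤ) ∣ c) {τ : ℂ} (hτ : 0 < τ.im) :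
    cosetTheta (2 * q) 0 ((a * τ + b) / (c * τ + d)) =
      jacobiSym d (2 * q + 1) * (c * τ + d) ^ q * cosetTheta (2 * q) 0 τ := by
  -- For odd `c`, first make `d` odd by a right translation, then replace `c` by `c + kd`, which is
  -- even, using a lower unipotent of level `k`.
  wlog hceven : Even c generalizing a b c d τ
  · rw [Int.not_even_iff_odd] at hceven
    wlog hd : Odd d generalizing a b d τ
    · have h := this (a := a) (b := a + b) (d := c + d) (by linarith)
        (τ := τ - 1) (by simpa using hτ) (by
          rw [Int.not_odd_iff_even] at hd; exact hceven.add_even hd)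
      have e1 : (a * (τ - 1) + (a + b : ℤ) : ℂ) = a * τ + b := by push_cast; ring
      have e2 : (c * (τ - 1) + (c + d : ℤ) : ℂ) = c * τ + d := by push_cast; ring
      have e3 : jacobiSym (c + d) (2 * q + 1) = jacobiSym d (2 * q + 1) := by
        apply jacobiSym.mod_left'
        rw [add_comm]
        exact (Int.emod_emod_of_dvd _ dvd_rfl).symm.trans (by
          obtain ⟨e, rfl⟩ := hc; simp)
      have e4 := cosetTheta_zero_add_int (2 * q) τ (-1)
      push_cast at e4
      rw [← sub_eq_add_neg] at e4
      rw [e1, e2, e3, e4] at h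
      exact h
    · set k : ℤ := ((2 * q + 1 : ℕ) : ℤ) with hk
      have hkodd : Odd k := ⟨q, by rw [hk]; push_cast; ring⟩
      have hB : ((k * (-1) : ℤ) * τ + 1 : ℂ) ≠ 0 := by
        have := int_mul_add_ne_zero (c := k * (-1)) (d := 1) isCoprime_one_right hτ
        rwa [Int.cast_one] at this
      have him : 0 < (τ / ((k * (-1) : ℤ) * τ + 1)).im := by
        have := moebius_im_pos (a := 1) (b := 0) (c := k * (-1)) (d := 1) (by ring) hτ
        simpa using this
      have h := this (a := a + k * b) (b := b) (c := c + k * d) (d := d) (by linarith)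
        (hc.add (dvd_mul_right _ _)) him (hceven.add_odd (hkodd.mul hd))
      rw [cosetTheta_lower_unipotent (-1) hτ, ← hk] at h
      set B : ℂ := (k * (-1) : ℤ) * τ + 1 with hBdef
      have e0 : ((c + k * d : ℤ) : ℂ) * (τ / B) + d = (c * τ + d) / B := by
        field_simp
        rw [hBdef]; push_cast; ring
      have e1 : ((a + k * b : ℤ) : ℂ) * (τ / B) + b = (a * τ + b) / B := by
        field_simp
        rw [hBdef]; push_cast; ring
      rw [e0, e1, div_div_div_cancel_right₀ hB] at h
      rw [h, div_pow]
      field_simp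
  obtain ⟨ha, hd⟩ := odd_of_det hdet hceven
  wlog hb : Even b generalizing a b
  · have hJ := int_mul_add_ne_zero (isCoprime_of_det hdet) hτ
    rw [Int.not_even_iff_odd] at hb
    have hdet' : (a + c) * d - (b + d) * c = 1 := by linarith
    have h := this hdet' (odd_of_det hdet' hceven).1 (hb.add_odd hd)
    rw [← h]
    have e : (((a + c : ℤ) : ℂ) * τ + (b + d : ℤ)) / (c * τ + d) =
        (a * τ + b) / (c * τ + d) + (1 : ℤ) := by
      push_cast; field_simp; ring
    rw [e, cosetTheta_zero_add_int]
  obtain ⟨e, rfl⟩ := hc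
  have heven : Even e := by
    rcases Int.even_mul.1 hceven with h | h
    · exact absurd h (by rw [Int.not_even_iff_odd]; exact ⟨q, by push_cast; ring⟩)
    · exact h
  have h1 := cosetTheta_zero_transform (r := 2 * q) hdet hb heven hτ
  have hJ := int_mul_add_ne_zero (isCoprime_of_det hdet) hτ
  have hcop := isCoprime_of_det hdet
  have h2 := isCoprime_two_of_odd hd
  have hk : (0 : ℤ) < (2 * q + 1 : ℕ) := by positivity
  have hM := thetaMult_ne_zero hd (h2.mul_left hcop.of_mul_left_right)
  have hs := cpow_half_ne_zero hJ
  set J : ℂ := ((2 * q + 1 : ℕ) * e : ℤ) * τ + d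
  apply mul_right_cancel₀ (mul_ne_zero hM hs)
  rw [h1]
  have hX := kroneckerSym_two_mul_mul hk hd hcop
  have hx := kroneckerSym_sq' hd (h2.mul_left hcop)
  have hε := eps_ne_zero d
  have hpr : (jacobiSym d (2 * q + 1) : ℂ) =
      (kroneckerSym (-1) d : ℂ) ^ q * kroneckerSym (2 * q + 1 : ℕ) d := by
    rw [← kroneckerSym_prime_disc ⟨q, rfl⟩, show (2 * q + 1 - 1) / 2 = q by lia,
      kroneckerSym_mul_cast hd (pow_ne_zero _ (by norm_num)) hk.ne', kroneckerSym_neg_one_pow hd]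
    push_cast
    rfl
  -- Because `ε_d⁴ = 1`; then `ε_d² = (-1/d)` supplies the sign `(-1)^q` in the discriminant.
  have hinv : (eps d)⁻¹ ^ 2 = eps d ^ 2 := by
    have h4 : (eps d ^ 2) ^ 2 = 1 := by
      rw [eps_sq hd]; exact kroneckerSym_sq' hd isCoprime_one_left.neg_left
    rw [inv_pow, inv_eq_iff_eq_inv]
    exact eq_inv_of_mul_eq_one_left (by rw [← sq]; exact h4)
  have e1 : (thetaMult ((2 * q + 1 : ℕ) * e) d) ^ (2 * q + 1) =
      (eps d ^ 2) ^ q * kroneckerSym (2 * ((2 * q + 1 : ℕ) * e)) d * (eps d)⁻¹ := by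
    rw [thetaMult, mul_pow, pow_succ, pow_mul, hx, pow_succ, pow_mul, hinv]
    ring
  rw [hpr, ← eps_sq hd, mul_pow, e1, hX, thetaMult, pow_succ (J ^ (1 / 2 : ℂ)), pow_mul (J ^ _),
    cpow_half_sq]
  ring

/-! ### The automorphy factor -/

theorem coe_smul_eq (γ : SL(2, ℤ)) (z : ℍ) :
    ((γ • z : ℍ) : ℂ) = ((γ 0 0 : ℂ) * z + (γ 0 1 : ℂ)) / ((γ 1 0 : ℂ) * z + (γ 1 1 : ℂ)) := by
  rw [UpperHalfPlane.coe_specialLinearGroup_apply]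
  simp

theorem det_entries (γ : SL(2, ℤ)) : γ 0 0 * γ 1 1 - γ 0 1 * γ 1 0 = 1 := by
  rw [← Matrix.det_fin_two]; exact γ.2

theorem cocyc_ne_zero (γ : SL(2, ℤ)) (z : ℍ) : cocyc γ z ≠ 0 :=
  int_mul_add_ne_zero (isCoprime_of_det (det_entries γ)) z.im_pos

theorem cocyc_mul (γ γ' : SL(2, ℤ)) (z : ℍ) :
    cocyc (γ * γ') z = cocyc γ (γ' • z) * cocyc γ' z := by
  have h := cocyc_ne_zero γ' z
  rw [cocyc] at h
  simp only [cocyc, coe_smul_eq, Matrix.SpecialLinearGroup.coe_mul, Matrix.mul_apply,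
    Fin.sum_univ_two]
  rw [← mul_div_assoc, div_add' _ _ _ h, div_mul_cancel₀ _ h]
  push_cast
  ring

theorem sqrtCocyc_ne_zero (γ : SL(2, ℤ)) (z : ℍ) : sqrtCocyc γ z ≠ 0 :=
  cpow_half_ne_zero (cocyc_ne_zero γ z)

theorem sqrtCocyc_sq (γ : SL(2, ℤ)) (z : ℍ) : sqrtCocyc γ z ^ 2 = cocyc γ z := cpow_half_sq _

theorem continuous_cocyc (γ : SL(2, ℤ)) : Continuous (cocyc γ) := by
  unfold cocyc
  exact (continuous_const.mul UpperHalfPlane.continuous_coe).add continuous_const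

theorem continuous_smul_upperHalfPlane (γ : SL(2, ℤ)) : Continuous fun z : ℍ => γ • z := by
  rw [UpperHalfPlane.isEmbedding_coe.continuous_iff]
  have : ((↑) : ℍ → ℂ) ∘ (fun z : ℍ => γ • z) =
      fun z : ℍ => ((γ 0 0 : ℂ) * z + (γ 0 1 : ℂ)) / cocyc γ z := funext (coe_smul_eq γ)
  rw [this]
  exact ((continuous_const.mul UpperHalfPlane.continuous_coe).add continuous_const).div
    (continuous_cocyc γ) (cocyc_ne_zero γ)

theorem continuous_sqrtCocyc (γ : SL(2, ℤ)) : Continuous (sqrtCocyc γ) := by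
  rcases eq_or_ne (γ 1 0) 0 with h | h
  · have : sqrtCocyc γ = fun _ => ((γ 1 1 : ℂ)) ^ (1 / 2 : ℂ) := by
      funext z; simp [sqrtCocyc, cocyc, h]
    rw [this]
    exact continuous_const
  · refine continuous_iff_continuousAt.2 fun z => ?_
    refine (continuous_cocyc γ).continuousAt.cpow continuousAt_const (mem_slitPlane_iff.2 (Or.inr ?_))
    simp [cocyc, h, z.im_ne_zero]

/-- The principal square root of the automorphy factor is a cocycle up to a constant sign. -/
theorem sqrtCocyc_mul (γ γ' : SL(2, ℤ)) : ∃ ε : ℂ, ε ^ 2 = 1 ∧ ∀ z : ℍ,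
    sqrtCocyc γ (γ' • z) * sqrtCocyc γ' z = ε * sqrtCocyc (γ * γ') z := by
  have hc : Continuous fun z : ℍ => sqrtCocyc γ (γ' • z) * sqrtCocyc γ' z :=
    ((continuous_sqrtCocyc γ).comp (continuous_smul_upperHalfPlane γ')).mul (continuous_sqrtCocyc γ')
  have h := (isPreconnected_univ (α := ℍ)).eq_or_eq_neg_of_sq_eq hc.continuousOn
    (continuous_sqrtCocyc (γ * γ')).continuousOn (fun z _ => by
      simp only [Pi.pow_apply, mul_pow, sqrtCocyc_sq, cocyc_mul]) fun {z} _ => sqrtCocyc_ne_zero _ z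
  rcases h with h | h
  · exact ⟨1, one_pow 2, fun z => by rw [one_mul]; exact h (Set.mem_univ z)⟩
  · exact ⟨-1, by norm_num, fun z => by rw [neg_one_mul]; exact h (Set.mem_univ z)⟩

/-! ### Behaviour at the cusps -/

/-- The space spanned by the theta series of the cosets of `A_r` in its dual lattice. -/
def cosetSpan (r : ℕ) : Submodule ℂ (ℍ → ℂ) :=
  Submodule.span ℂ (Set.range fun (t : ZMod (r + 1)) (z : ℍ) => cosetTheta r t.val z)

theorem cosetTheta_mem_cosetSpan (r : ℕ) (t : ZMod (r + 1)) :
    (fun z : ℍ => cosetTheta r t.val z) ∈ cosetSpan r :=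
  Submodule.subset_span ⟨t, rfl⟩

/-- The weight `r / 2` slash operator of `γ` preserves `cosetSpan r`. -/
def PreservesCosetSpan (r : ℕ) (γ : SL(2, ℤ)) : Prop :=
  ∀ f ∈ cosetSpan r, ∃ g ∈ cosetSpan r, ∀ z : ℍ, f (γ • z) = sqrtCocyc γ z ^ r * g z

theorem PreservesCosetSpan.of_generators {r : ℕ} {γ : SL(2, ℤ)}
    (h : ∀ t : ZMod (r + 1), ∃ g ∈ cosetSpan r, ∀ z : ℍ,
      cosetTheta r t.val (γ • z : ℍ) = sqrtCocyc γ z ^ r * g z) : PreservesCosetSpan r γ := by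
  intro f hf
  induction hf using Submodule.span_induction with
  | mem f hf => obtain ⟨t, rfl⟩ := hf; exact h t
  | zero => exact ⟨0, zero_mem _, fun z => by simp⟩
  | add f₁ f₂ _ _ h₁ h₂ =>
    obtain ⟨g₁, hg₁, e₁⟩ := h₁
    obtain ⟨g₂, hg₂, e₂⟩ := h₂
    exact ⟨g₁ + g₂, add_mem hg₁ hg₂, fun z => by simp only [Pi.add_apply, e₁, e₂]; ring⟩
  | smul a f _ h =>
    obtain ⟨g, hg, e⟩ := h
    exact ⟨a • g, Submodule.smul_mem _ _ hg, fun z => by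
      simp only [Pi.smul_apply, e, smul_eq_mul]; ring⟩

theorem PreservesCosetSpan.mul {r : ℕ} {γ γ' : SL(2, ℤ)} (h : PreservesCosetSpan r γ)
    (h' : PreservesCosetSpan r γ') : PreservesCosetSpan r (γ * γ') := by
  intro f hf
  obtain ⟨g, hg, e⟩ := h f hf
  obtain ⟨g', hg', e'⟩ := h' g hg
  obtain ⟨ε, -, hε⟩ := sqrtCocyc_mul γ γ'
  refine ⟨ε ^ r • g', Submodule.smul_mem _ _ hg', fun z => ?_⟩
  rw [mul_smul, e, e', Pi.smul_apply, smul_eq_mul, ← mul_assoc, ← mul_pow, hε, mul_pow]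
  ring

theorem preservesCosetSpan_of_translation {r : ℕ} {γ : SL(2, ℤ)} (n : ℤ)
    (h : ∀ z : ℍ, ((γ • z : ℍ) : ℂ) = z + n) (h' : ∀ z, cocyc γ z = 1) :
    PreservesCosetSpan r γ := by
  refine .of_generators fun t => ?_
  refine ⟨cexp (Real.pi * I * ((t.val : ℤ) - ((t.val : ℤ) : ℂ) ^ 2 / (r + 1)) * n) •
    fun z : ℍ => cosetTheta r t.val z, Submodule.smul_mem _ _ (cosetTheta_mem_cosetSpan r t),
    fun z => ?_⟩
  rw [h, cosetTheta_add_int, sqrtCocyc, h', one_cpow, one_pow, one_mul]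
  rfl

theorem preservesCosetSpan_S (r : ℕ) : PreservesCosetSpan r ModularGroup.S := by
  refine .of_generators fun t => ?_
  refine ⟨(inversionConst r * ((-I) ^ (1 / 2 : ℂ)) ^ r) • ∑ s : ZMod (r + 1),
    ZMod.stdAddChar (t * s) • fun z : ℍ => cosetTheta r s.val z,
    Submodule.smul_mem _ _ (Submodule.sum_mem _ fun s _ =>
      Submodule.smul_mem _ _ (cosetTheta_mem_cosetSpan r s)), fun z => ?_⟩
  have e1 : ((ModularGroup.S • z : ℍ) : ℂ) = -1 / z := by
    rw [coe_smul_eq]; simp [ModularGroup.S]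
  have e2 : sqrtCocyc ModularGroup.S z = (z : ℂ) ^ (1 / 2 : ℂ) := by
    rw [sqrtCocyc, cocyc]; simp [ModularGroup.S]
  -- The arguments `-π/2` and `arg z` in `[0, π]` add up within the principal range.
  have e3 : (-I * z) ^ (1 / 2 : ℂ) = (-I) ^ (1 / 2 : ℂ) * (z : ℂ) ^ (1 / 2 : ℂ) := by
    have h1 : 0 ≤ (z : ℂ).arg := arg_nonneg_iff.2 z.im_pos.le
    have h2 := arg_le_pi (z : ℂ)
    have := Real.pi_pos
    refine mul_cpow_half (by simp) z.ne_zero ?_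
    rw [arg_neg_I]
    constructor <;> linarith
  rw [e1, e2, cosetTheta_neg_one_div r t z.im_pos, e3]
  simp only [Pi.smul_apply, Finset.sum_apply, smul_eq_mul, mul_pow]
  ring

/-- Checked on the generators `S` and `T`; inverses are carried along because the closure induction
has an inversion step. -/
theorem preservesCosetSpan (r : ℕ) (γ : SL(2, ℤ)) : PreservesCosetSpan r γ := by
  suffices h : PreservesCosetSpan r γ ∧ PreservesCosetSpan r γ⁻¹ from h.1
  have hγ : γ ∈ Subgroup.closure {ModularGroup.S, ModularGroup.T} := by
    rw [SpecialLinearGroup.SL2Z_generators]; trivial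
  induction hγ using Subgroup.closure_induction with
  | mem x hx =>
    rcases hx with rfl | rfl
    · have hS := preservesCosetSpan_S r
      refine ⟨hS, ?_⟩
      have : (ModularGroup.S)⁻¹ = ModularGroup.S * (ModularGroup.S * ModularGroup.S) := by decide
      rw [this]
      exact hS.mul (hS.mul hS)
    · refine ⟨preservesCosetSpan_of_translation 1 (fun z => ?_) fun z => ?_,
        preservesCosetSpan_of_translation (-1) (fun z => ?_) fun z => ?_⟩
      · rw [coe_smul_eq]; simp [ModularGroup.coe_T]
      · rw [cocyc]; simp [ModularGroup.coe_T]
      · rw [coe_smul_eq]; simp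
      · rw [cocyc]; simp
  | one =>
    have h : PreservesCosetSpan r 1 := fun f hf => ⟨f, hf, fun z => by simp [sqrtCocyc, cocyc]⟩
    exact ⟨h, by rwa [inv_one]⟩
  | mul x y _ _ hx hy => exact ⟨hx.1.mul hy.1, by rw [mul_inv_rev]; exact hy.2.mul hx.2⟩
  | inv x _ hx => exact ⟨hx.2, by rw [inv_inv]; exact hx.1⟩

/-- Cauchy–Schwarz for a vector of length `r + 1` with coordinate sum `s`; it excludes negative
exponents at the cusps. -/
theorem sq_le_mul_sqSum {r : ℕ} (s : ℤ) (m : Fin r → ℤ) : s ^ 2 ≤ (r + 1) * sqSum s m := by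
  have h := sq_sum_le_card_mul_sum_sq (s := Finset.univ)
    (f := (Fin.cons (s - ∑ i, m i) m : Fin (r + 1) → ℤ))
  simp only [Fin.sum_univ_succ, Fin.cons_zero, Fin.cons_succ, Finset.card_univ, Fintype.card_fin,
    sub_add_cancel] at h
  rw [sqSum, add_comm (∑ i, m i ^ 2)]
  exact_mod_cast h

theorem hasSum_qParam_of_mem_cosetSpan {r : ℕ} {f : ℍ → ℂ} (hf : f ∈ cosetSpan r) :
    ∃ a : ℕ → ℂ, ∀ z : ℍ, HasSum (fun n : ℕ =>
      a n * Function.Periodic.qParam ((2 * (r + 1) : ℕ) : ℝ) (z : ℂ) ^ ((0 : ℤ) + (n : ℤ))) (f z) := by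
  induction hf using Submodule.span_induction with
  | mem f hf =>
    obtain ⟨t, rfl⟩ := hf
    set s : ℤ := (t.val : ℤ) with hs
    have hr := natCast_add_one_ne_zero r
    have hex (m : Fin r → ℤ) : ∃ e : ℕ, (e : ℤ) = (r + 1) * sqSum s m - s ^ 2 :=
      ⟨((r + 1) * sqSum s m - s ^ 2).toNat, Int.toNat_of_nonneg (sub_nonneg.2 (sq_le_mul_sqSum s m))⟩
    choose e he using hex
    -- The coefficient counts the coset vectors with `(r + 1)|x|² - s² = n`; the width `2(r + 1)`
    -- clears the denominator `r + 1` and the factor 1/2 of `πi`.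
    refine ⟨fun n => ∑' _ : e ⁻¹' {n}, (1 : ℂ), fun z => ?_⟩
    have h := (summable_cosetTheta r s z.im_pos).hasSum.tsum_fiberwise e
    refine hasSum_of_eq h fun n => ?_
    rw [← tsum_mul_right]
    refine tsum_congr fun m => ?_
    have hm : e m = n := m.2
    have he' : (n : ℂ) = (r + 1) * sqSum s m.1 - s ^ 2 := by
      have hm' := he m.1
      rw [hm] at hm'
      exact_mod_cast hm'
    rw [one_mul, zero_add, zpow_natCast, Function.Periodic.qParam, ← exp_nat_mul, he']
    congr 1
    push_cast
    field_simp
  | zero => exact ⟨0, fun z => by simp⟩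
  | add f₁ f₂ _ _ h₁ h₂ =>
    obtain ⟨a₁, e₁⟩ := h₁
    obtain ⟨a₂, e₂⟩ := h₂
    exact ⟨a₁ + a₂, fun z => hasSum_of_eq ((e₁ z).add (e₂ z)) fun n => by
      rw [Pi.add_apply, add_mul]⟩
  | smul c f _ h =>
    obtain ⟨a, e⟩ := h
    exact ⟨c • a, fun z => hasSum_of_eq ((e z).mul_left c) fun n => by
      rw [Pi.smul_apply, smul_eq_mul, mul_assoc]⟩

theorem theta_eq (r : ℕ) : theta (r + 1) = fun z : ℍ => cosetTheta r 0 z :=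
  funext (theta_succ r)

theorem hasCuspExpansion_theta (r : ℕ) (γ : SL(2, ℤ)) :
    HasCuspExpansion r (theta (r + 1)) γ 0 := by
  have hmem : theta (r + 1) ∈ cosetSpan r := by
    have := cosetTheta_mem_cosetSpan r 0
    rw [ZMod.val_zero] at this
    rwa [theta_eq]
  obtain ⟨g, hg, e⟩ := preservesCosetSpan r γ _ hmem
  obtain ⟨a, ha⟩ := hasSum_qParam_of_mem_cosetSpan hg
  refine ⟨2 * (r + 1), by positivity, a, fun z => ?_⟩
  have hne := pow_ne_zero r (sqrtCocyc_ne_zero γ z)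
  rw [e, zpow_neg, zpow_natCast, inv_mul_cancel_left₀ hne]
  exact ha z

/-! ### Holomorphy -/

/-- On `Im w > δ` the series is dominated termwise by its value at `δi`, since the exponents are
nonnegative. -/
theorem differentiableOn_cosetTheta_zero (r : ℕ) :
    DifferentiableOn ℂ (cosetTheta r 0) {τ | 0 < τ.im} := by
  intro τ hτ
  obtain ⟨δ, h0, hδ⟩ := exists_between (show 0 < τ.im from hτ)
  have hopen : IsOpen {w : ℂ | δ < w.im} := isOpen_lt continuous_const continuous_im
  have hs := (summable_cosetTheta r 0 (τ := δ * I) (by simpa using h0)).norm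
  have hd : DifferentiableOn ℂ (cosetTheta r 0) {w : ℂ | δ < w.im} := by
    refine differentiableOn_tsum_of_summable_norm hs (fun m => ?_) hopen fun m w hw => ?_
    · fun_prop
    · have hn (w : ℂ) : ‖cexp (Real.pi * I * w * (sqSum 0 m - (0 : ℤ) ^ 2 / (r + 1)))‖ =
          Real.exp (-(Real.pi * sqSum 0 m * w.im)) := by
        rw [norm_exp]
        congr 1
        have : Real.pi * I * w * (sqSum 0 m - (0 : ℤ) ^ 2 / (r + 1)) =
            ((Real.pi * sqSum 0 m : ℝ) : ℂ) * (w * I) := by push_cast; ring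
        rw [this, re_ofReal_mul, mul_I_re, mul_neg]
      have hp : (0 : ℝ) ≤ sqSum 0 m := by
        have : 0 ≤ sqSum 0 m := by unfold sqSum; positivity
        exact_mod_cast this
      rw [hn, hn, Real.exp_le_exp, neg_le_neg_iff]
      have : ((δ : ℂ) * I).im = δ := by simp
      rw [this]
      exact mul_le_mul_of_nonneg_left (le_of_lt hw) (mul_nonneg Real.pi_pos.le hp)
  exact (hd.differentiableAt (hopen.mem_nhds hδ)).differentiableWithinAt

theorem mdifferentiable_theta (r : ℕ) : MDiff (theta (r + 1)) := by
  rw [UpperHalfPlane.mdifferentiable_iff]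
  refine (differentiableOn_cosetTheta_zero r).congr fun τ hτ => ?_
  rw [Function.comp_apply, theta_succ, UpperHalfPlane.ofComplex_apply_of_im_pos hτ]

/-! ### Transformation laws -/

theorem transforms_theta_of_even (q : ℕ) :
    Transforms ((2 * q : ℕ) : ℤ) (2 * q + 1) (jacobiChar (2 * q + 1)) (theta (2 * q + 1)) := by
  intro γ hγ z
  rw [CongruenceSubgroup.Gamma0_mem, ZMod.intCast_zmod_eq_zero_iff_dvd] at hγ
  have h := cosetTheta_transform_of_even (det_entries γ) hγ z.im_pos
  have hκ : Even ((2 * q : ℕ) : ℤ) := by simp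
  have hq : ((2 * q : ℕ) : ℤ) / 2 = (q : ℕ) := by lia
  rw [theta_succ, theta_succ, coe_smul_eq, h, jacobiChar_intCast, autFactor, if_pos hκ, hq,
    zpow_natCast]
  rfl

theorem transforms_theta_of_odd {r a : ℕ} [NeZero a] (hr : Odd r) (ha : r + 1 = 2 * a) :
    Transforms r (4 * a) (kroneckerChar a) (theta (r + 1)) := by
  intro γ hγ z
  rw [CongruenceSubgroup.Gamma0_mem, ZMod.intCast_zmod_eq_zero_iff_dvd] at hγ
  have hN : 4 * a = 2 * (r + 1) := by lia
  have h := cosetTheta_transform_of_odd hr (det_entries γ) (by rwa [hN] at hγ) z.im_pos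
  have hκ : ¬ Even (r : ℤ) := by rw [Int.not_even_iff_odd]; exact_mod_cast hr
  rw [theta_succ, theta_succ, coe_smul_eq, h, kroneckerChar_intCast, autFactor, if_neg hκ,
    zpow_natCast]
  rw [show (4 * a : ℤ) = 2 * (r + 1 : ℕ) by lia]
  rfl

end FrobTheta

end

theorem mainTheorem8 (k : ℕ) (hk : 0 < k) :
    (∀ z : UpperHalfPlane, Summable (fun m : Fin (k - 1) → ℤ => FrobTheta.thetaTerm z m)) ∧
    (Odd k →
      ∃ χ : DirichletCharacter ℂ k,
        (∀ d : ℤ, χ (d : ZMod k) =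
          (FrobTheta.kroneckerSym ((-1) ^ ((k - 1) / 2) * (k : ℤ)) d : ℂ)) ∧
        FrobTheta.theta k ∈ FrobTheta.holModForms ((k : ℤ) - 1) k χ) ∧
    (Even k →
      ∃ χ : DirichletCharacter ℂ (2 * k),
        (∀ d : ℤ, χ (d : ZMod (2 * k)) = (FrobTheta.kroneckerSym (2 * (k : ℤ)) d : ℂ)) ∧
        FrobTheta.theta k ∈ FrobTheta.weakHolModForms ((k : ℤ) - 1) (2 * k) χ) := by
  refine ⟨fun z => FrobTheta.summable_thetaTerm z, fun hodd => ?_, fun heven => ?_⟩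
  · obtain ⟨q, rfl⟩ := hodd
    have hκ : ((2 * q + 1 : ℕ) : ℤ) - 1 = (2 * q : ℕ) := by lia
    rw [hκ]
    refine ⟨FrobTheta.jacobiChar (2 * q + 1), fun d => ?_, FrobTheta.mdifferentiable_theta _,
      FrobTheta.transforms_theta_of_even q, FrobTheta.hasCuspExpansion_theta _⟩
    rw [FrobTheta.jacobiChar_intCast, FrobTheta.kroneckerSym_prime_disc ⟨q, rfl⟩]
  · obtain ⟨a, ha⟩ := heven
    obtain ⟨r, rfl⟩ : ∃ r, k = r + 1 := ⟨k - 1, by lia⟩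
    have : NeZero a := ⟨by lia⟩
    have hκ : ((r + 1 : ℕ) : ℤ) - 1 = r := by lia
    have hN : 2 * (r + 1) = 4 * a := by lia
    rw [hκ, hN]
    refine ⟨FrobTheta.kroneckerChar a, fun d => ?_, FrobTheta.mdifferentiable_theta _,
      FrobTheta.transforms_theta_of_odd (by rw [Nat.odd_iff]; lia) (by lia),
      fun γ => ⟨0, FrobTheta.hasCuspExpansion_theta _ γ⟩⟩
    rw [FrobTheta.kroneckerChar_intCast, show (4 * a : ℤ) = 2 * ((r + 1 : ℕ) : ℤ) by lia]
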